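/- Hyperuniformerer. Let $d\ge 1$ and let $(\Omega,\mathcal A,\mathbb P)$ be a probability space with a measurable flow $(\theta_x)_{x\in\mathbb R^d}$ (i.e. $(\omega,x)\mapsto\theta_x\omega$ is measurable, $\theta_0=\mathrm{id}$, $\theta_x\circ\theta_y=\theta_{x+y}$) that leaves $\mathbb P$ invariant. Let $(\Psi,\tau)$ be an invariant partition: $\Psi$ is a simple point process on $\mathbb R^d$ with $\Psi(\theta_x\omega,B)=\Psi(\omega,B+x)$, with finite intensity $\gamma=\mathbb E\,\Psi([0,1]^d)$ and $\mathbb P(\Psi(\mathbb R^d)=0)=0$, and $\tau\colon\Omega\times\mathbb R^d\to\mathbb R^d\cup\{\infty\}$ is measurable with $\tau(\theta_y\omega,x-y)=\tau(\omega,x)-y$ for all $\omega,x,y$ and $\tau(\omega,x)\in\Psi(\omega)$ for all $x$ whenever $\Psi(\omega)\neq0$. Put $C^\tau(x)=\{y:\tau(y)=x\}$ and $V_0=\{x:\tau(x)=\tau(0)\}$, and assume that the partition is fair: almost surely $\lambda_d(C^\tau(x))=\gamma^{-1}$ for all $x\in\Psi$. Let $T=\sum_{x\in\Psi}\delta_x\otimes\lambda_d(C^\tau(x)\cap\cdot)$,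 and let $Z(x)$, $x\in\Psi$, be random vectors which are conditionally independent given $T$, with $Z(x)$ conditionally uniformly distributed on $C^\tau(x)$. Set $\Gamma=\sum_{x\in\Psi}\delta_{Z(x)}$. For a stationary locally square-integrable random measure $\Phi$ of intensity $\gamma_\Phi$ put $\alpha_\Phi(B)=\mathbb E\iint \mathbf 1\{x\in[0,1]^d,\,y-x\in B\}\,\Phi(dy)\,\Phi(dx)$ and $\beta_\Phi=\alpha_\Phi-\gamma_\Phi^2\lambda_d$. The Bartlett spectral measure $\hat\beta_\Phi$ is the locally finite measure with $\int f\star g\,d\beta_\Phi=(2\pi)^{-d}\int\hat f\,\overline{\hat g}\,d\hat\beta_\Phi$ for all bounded measurable $f,g\colon\mathbb R^d\to\mathbb R$ with bounded support, where $(f\star g)(y)=\int f(x)g(x-y)\,dx$ and $\hat f(k)=\int f(x)e^{-i\langle k,x\rangle}dx$. If $\beta_\Phi$ has finite total variation, the structure factor $S_\Phi$ is the continuous function with $\hat\beta_\Phi(dk)=\gamma_\Phi S_\Phi(k)\,dk$. Then $\Gamma$ is a point process which is hyperuniform, that is, stationary and locally square-integrable with $\lim_{r\to\infty}\lambda_d(rW)^{-1}\operatorname{Var}\Gamma(rW)=0$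 for $W$ the unit ball. The measures $\beta_\Gamma$ and $\beta_{\gamma^{-1}\Gamma}$ have finite total variation, and for all $k\in\mathbb R^d$ $$S_\Gamma(k)=\gamma^2\Big(\gamma^{-2}-\mathbb E\big|\widehat{\mathbf 1_{V_0}}(k)\big|^2\Big),\qquad S_{\gamma^{-1}\Gamma}(k)=\gamma\Big(\gamma^{-2}-\mathbb E\big|\widehat{\mathbf 1_{V_0}}(k)\big|^2\Big),$$ where moreover $\mathbb E|\widehat{\mathbf 1_{V_0}}(k)|^2=\mathbb E_0^\Psi|\widehat{\mathbf 1_{C^\tau(0)}}(k)|^2$, with $\mathbb E_0^\Psi$ the expectation under the Palm probability measure $\mathbb P_0^\Psi(A)=\gamma^{-1}\,\mathbb E\int\mathbf 1\{\theta_x\in A\}\mathbf 1\{x\in[0,1]^d\}\,\Psi(dx)$. -/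

import Mathlib

open MeasureTheory ProbabilityTheory Filter Topology
open scoped ENNReal Pointwise

noncomputable section

namespace RandomMeasures

/-- Euclidean space `ℝ^d`. -/
abbrev Space (d : ℕ) : Type := EuclideanSpace ℝ (Fin d)

/-- The unit cube `[0,1]^d`. -/
def unitCube (d : ℕ) : Set (Space d) := {x | ∀ i, x i ∈ Set.Icc (0 : ℝ) 1}

/-- The shift `θ_x φ = φ(· + x)` of a measure on `ℝ^d`. -/
def shiftMeasure {d : ℕ} (x : Space d) (φ : Measure (Space d)) : Measure (Space d) :=
  φ.map (fun y => y - x)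

/-- The points (atoms) `x ∈ φ` of a measure. -/
def points {d : ℕ} (φ : Measure (Space d)) : Set (Space d) := {x | φ {x} ≠ 0}

/-- The measure takes its values in `ℕ ∪ {∞}`. -/
def IsIntegerValued {d : ℕ} (φ : Measure (Space d)) : Prop :=
  ∀ B : Set (Space d), MeasurableSet B → ∃ n : ℕ∞, φ B = (n : ℝ≥0∞)

section RandomMeasure

variable {Ω : Type*} [MeasurableSpace Ω] {d : ℕ}

/-- `Φ` is (almost surely equal to) a random locally finite measure on `ℝ^d`. -/
structure IsRandomMeasure (P : Measure Ω) (Φ : Ω → Measure (Space d)) : Prop where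
  aemeasurable : AEMeasurable Φ P
  locallyFinite : ∀ᵐ ω ∂P, IsLocallyFiniteMeasure (Φ ω)

/-- `Φ` is (almost surely equal to) a point process on `ℝ^d`. -/
structure IsPointProcess (P : Measure Ω) (Φ : Ω → Measure (Space d)) : Prop
    extends IsRandomMeasure P Φ where
  integerValued : ∀ᵐ ω ∂P, IsIntegerValued (Φ ω)

/-- Distributional stationarity: `θ_x Φ` and `Φ` have the same law for all `x`. -/
def IsStationary (P : Measure Ω) (Φ : Ω → Measure (Space d)) : Prop :=
  ∀ x : Space d, P.map (fun ω => shiftMeasure x (Φ ω)) = P.map Φ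

/-- `E Φ(B)² < ∞` for all bounded Borel sets `B`. -/
def IsLocallySquareIntegrable (P : Measure Ω) (Φ : Ω → Measure (Space d)) : Prop :=
  ∀ B : Set (Space d), MeasurableSet B → Bornology.IsBounded B →
    ∫⁻ ω, (Φ ω B) ^ 2 ∂P < ∞

/-- The intensity `E Φ([0,1]^d)`. -/
def intensity (P : Measure Ω) (Φ : Ω → Measure (Space d)) : ℝ≥0∞ :=
  ∫⁻ ω, Φ ω (unitCube d) ∂P

/-- `Φ` is hyperuniform with respect to `W`: it is a stationary locally square-integrable random
measure and `λ(rW)⁻¹ Var Φ(rW) → 0` as `r → ∞`. -/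
structure IsHyperuniformWrt (P : Measure Ω) (Φ : Ω → Measure (Space d))
    (W : Set (Space d)) : Prop where
  randomMeasure : IsRandomMeasure P Φ
  stationary : IsStationary P Φ
  squareIntegrable : IsLocallySquareIntegrable P Φ
  tendsto_variance :
    Tendsto (fun r : ℝ => (volume.real (r • W))⁻¹ * variance (fun ω => (Φ ω).real (r • W)) P)
      atTop (𝓝 0)

/-- Hyperuniformity, i.e. hyperuniformity with respect to the unit ball. -/
def IsHyperuniform (P : Measure Ω) (Φ : Ω → Measure (Space d)) : Prop :=
  IsHyperuniformWrt P Φ (Metric.closedBall 0 1)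

/-- The reduced second moment measure
`α_Φ(B) = E ∫∫ 1{x ∈ [0,1]^d, y - x ∈ B} Φ(dy) Φ(dx)`. -/
def reducedSecondMoment (P : Measure Ω) (Φ : Ω → Measure (Space d)) : Measure (Space d) :=
  P.bind (fun ω => (((Φ ω).restrict (unitCube d)).prod (Φ ω)).map (fun p => p.2 - p.1))

/-- The covariance measure `β_Φ = α_Φ - γ² λ` (a priori a set function on bounded Borel sets)
has finite total variation: it extends to a finite signed measure on all Borel sets. -/
def CovarianceMeasureFiniteVariation (P : Measure Ω) (Φ : Ω → Measure (Space d)) : Prop :=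
  ∃ ν : SignedMeasure (Space d), ∀ B : Set (Space d), MeasurableSet B → Bornology.IsBounded B →
    ν B = (reducedSecondMoment P Φ).real B - (intensity P Φ).toReal ^ 2 * volume.real B

/-- The Fourier transform `f̂(k) = ∫ f(x) e^{-i⟨k,x⟩} dx`. -/
def fourierTr (f : Space d → ℝ) (k : Space d) : ℂ :=
  ∫ x, (f x : ℂ) * Complex.exp (-(Complex.I * ((inner ℝ k x : ℝ) : ℂ)))

/-- The tilted convolution `(f ⋆ g)(y) = ∫ f(x) g(x - y) dx`. -/
def tiltedConv (f g : Space d → ℝ) (y : Space d) : ℝ := ∫ x, f x * g (x - y)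

/-- Bounded measurable functions with bounded support. -/
structure IsTestFunction (f : Space d → ℝ) : Prop where
  measurable : Measurable f
  bounded : ∃ c : ℝ, ∀ x, |f x| ≤ c
  bounded_support : Bornology.IsBounded (Function.support f)

/-- `μ` is the Bartlett spectral measure of `Φ`, the Fourier transform of `β_Φ = α_Φ - γ² λ`:
`∫ f ⋆ g dβ_Φ = (2π)^{-d} ∫ f̂ conj(ĝ) dμ` for all test functions `f`, `g`. -/
structure IsBartlettSpectralMeasure (P : Measure Ω) (Φ : Ω → Measure (Space d))
    (μ : Measure (Space d)) : Prop where
  locallyFinite : IsLocallyFiniteMeasure μ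
  integrable : ∀ f g : Space d → ℝ, IsTestFunction f → IsTestFunction g →
    Integrable (fun k => fourierTr f k * (starRingEnd ℂ) (fourierTr g k)) μ
  spectral : ∀ f g : Space d → ℝ, IsTestFunction f → IsTestFunction g →
    (((∫ y, tiltedConv f g y ∂(reducedSecondMoment P Φ))
        - (intensity P Φ).toReal ^ 2 * ∫ y, tiltedConv f g y : ℝ) : ℂ)
      = (((2 * Real.pi) ^ d)⁻¹ : ℝ) * ∫ k, fourierTr f k * (starRingEnd ℂ) (fourierTr g k) ∂μ

/-- `S` is the structure factor of the stationary locally square-integrable random measure `Φ`: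
the covariance measure has finite total variation, `S` is continuous (and nonnegative), and the
Bartlett spectral measure is `γ_Φ S(k) dk`, with `γ_Φ` the intensity of `Φ`. -/
structure IsStructureFactor (P : Measure Ω) (Φ : Ω → Measure (Space d))
    (S : Space d → ℝ) : Prop where
  randomMeasure : IsRandomMeasure P Φ
  stationary : IsStationary P Φ
  squareIntegrable : IsLocallySquareIntegrable P Φ
  finiteVariation : CovarianceMeasureFiniteVariation P Φ
  continuous : Continuous S
  nonneg : ∀ k, 0 ≤ S k
  density : IsBartlettSpectralMeasure P Φ
    ((volume : Measure (Space d)).withDensity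
      (fun k => ENNReal.ofReal ((intensity P Φ).toReal * S k)))

end RandomMeasure

section Partition

variable {Ω : Type*} [MeasurableSpace Ω] {d : ℕ}

/-- The cell `C^τ(x) = {y : τ(y) = x}` with center `x`. Allocations take values in
`ℝ^d ∪ {∞}`, with `none` in the role of `∞`. -/
def cell (τ : Ω → Space d → Option (Space d)) (ω : Ω) (x : Space d) : Set (Space d) :=
  {y | τ ω y = some x}

/-- The zero cell `V_0 = {x : τ(x) = τ(0)}`. -/
def zeroCell (τ : Ω → Space d → Option (Space d)) (ω : Ω) : Set (Space d) :=
  {x | τ ω x = τ ω 0}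

/-- An invariant partition `(Ψ, τ)`: an invariant simple point process `Ψ` with finite intensity
and almost surely at least one point, and an invariant allocation `τ` with values in `Ψ`.
The flow is the given action of `ℝ^d` on `Ω`, `θ_x ω = x +ᵥ ω`. -/
structure IsInvariantPartition [AddAction (Space d) Ω] (P : Measure Ω)
    (Ψ : Ω → Measure (Space d)) (τ : Ω → Space d → Option (Space d)) : Prop where
  measurable : Measurable Ψ
  locallyFinite : ∀ ω, IsLocallyFiniteMeasure (Ψ ω)
  integerValued : ∀ ω, IsIntegerValued (Ψ ω)
  simple : ∀ᵐ ω ∂P, ∀ x, Ψ ω {x} = 0 ∨ Ψ ω {x} = 1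
  invariant : ∀ ω (x : Space d), Ψ (x +ᵥ ω) = shiftMeasure x (Ψ ω)
  intensity_ne_top : intensity P Ψ ≠ ∞
  nonzero : ∀ᵐ ω ∂P, Ψ ω Set.univ ≠ 0
  /-- joint measurability of `τ` as a map into `ℝ^d ∪ {∞}` -/
  measurable_allocation : ∀ B : Set (Space d), MeasurableSet B →
    MeasurableSet {p : Ω × Space d | ∃ z ∈ B, τ p.1 p.2 = some z}
  equivariant : ∀ ω (x y : Space d), τ (y +ᵥ ω) (x - y) = (τ ω x).map (fun z => z - y)
  allocation_mem : ∀ ω, Ψ ω ≠ 0 → ∀ x, ∃ z ∈ points (Ψ ω), τ ω x = some z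

/-- The partition is fair: almost surely, all cells have volume `γ⁻¹`. -/
def IsFair (P : Measure Ω) (Ψ : Ω → Measure (Space d))
    (τ : Ω → Space d → Option (Space d)) : Prop :=
  ∀ᵐ ω ∂P, ∀ x ∈ points (Ψ ω), volume (cell τ ω x) = (intensity P Ψ)⁻¹

/-- The random transport `T = ∫∫ 1{(x,y) ∈ ·} 1{y ∈ C^τ(x)} dy Ψ(dx)` for a simple `Ψ`. -/
def transport (Ψ : Ω → Measure (Space d)) (τ : Ω → Space d → Option (Space d)) (ω : Ω) :
    Measure (Space d × Space d) :=
  Measure.sum (fun x : points (Ψ ω) =>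
    (Measure.dirac (x : Space d)).prod (volume.restrict (cell τ ω x)))

/-- The σ-field `σ(T)`. -/
abbrev transportSigma (Ψ : Ω → Measure (Space d)) (τ : Ω → Space d → Option (Space d)) :
    MeasurableSpace Ω :=
  MeasurableSpace.comap (transport Ψ τ) inferInstance

/-- The random vectors `Z(x)`, `x ∈ Ψ`, are conditionally independent given `T`, and `Z(x)` is
conditionally uniform on the cell `C^τ(x)`. The random index set is handled by a `T`-measurable
enumeration `X_0, X_1, …` of the points of `Ψ` without repetitions. The measure
`cond volume C` is the uniform distribution `λ(C)⁻¹ λ(C ∩ ·)`. -/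
def IsConditionallyUniform (P : Measure Ω) (Ψ : Ω → Measure (Space d))
    (τ : Ω → Space d → Option (Space d)) (Z : Ω → Space d → Space d) : Prop :=
  ∃ X : ℕ → Ω → Space d,
    (∀ n, Measurable[transportSigma Ψ τ] (X n)) ∧
    (∀ᵐ ω ∂P, Function.Injective (fun n => X n ω) ∧
      Set.range (fun n => X n ω) = points (Ψ ω)) ∧
    (∀ n, AEMeasurable (fun ω => Z ω (X n ω)) P) ∧
    -- conditional distributions
    (∀ (n : ℕ) (A : Set (Space d)), MeasurableSet A →
      P[{ω | Z ω (X n ω) ∈ A}.indicator (fun _ => (1 : ℝ)) | transportSigma Ψ τ]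
        =ᵐ[P] fun ω => (ProbabilityTheory.cond volume (cell τ ω (X n ω))).real A) ∧
    -- conditional independence
    (∀ (s : Finset ℕ) (A : ℕ → Set (Space d)), (∀ n, MeasurableSet (A n)) →
      P[{ω | ∀ n ∈ s, Z ω (X n ω) ∈ A n}.indicator (fun _ => (1 : ℝ)) | transportSigma Ψ τ]
        =ᵐ[P] fun ω => ∏ n ∈ s,
          (P[{ω' | Z ω' (X n ω') ∈ A n}.indicator (fun _ => (1 : ℝ)) | transportSigma Ψ τ]) ω)

/-- The point process `Γ = ∑_{x ∈ Ψ} δ_{Z(x)}`. -/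
def displaced (Ψ : Ω → Measure (Space d)) (Z : Ω → Space d → Space d) (ω : Ω) :
    Measure (Space d) :=
  Measure.sum (fun x : points (Ψ ω) => Measure.dirac (Z ω x))

/-- The Palm probability measure of `Ψ`,
`P_0(A) = γ⁻¹ E ∫ 1{θ_x ω ∈ A} 1{x ∈ [0,1]^d} Ψ(dx)`. -/
def palm [AddAction (Space d) Ω] (P : Measure Ω) (Ψ : Ω → Measure (Space d)) : Measure Ω :=
  (intensity P Ψ)⁻¹ • P.bind (fun ω => ((Ψ ω).restrict (unitCube d)).map (fun x => x +ᵥ ω))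

/-- `|1̂_B(k)|²`, the squared modulus of the Fourier transform of the indicator of `B`. -/
def indicatorFourierSq (B : Set (Space d)) (k : Space d) : ℝ :=
  ‖fourierTr (B.indicator (fun _ => (1 : ℝ))) k‖ ^ 2

end Partition

end RandomMeasures

end

open RandomMeasures

/-! Given the partition, Γ consists of independent points, one uniform in each cell, and every cell
has volume γ⁻¹. In the second moment of Γ the coinciding pairs contribute γ∫F(x,x)dx. The distinct
pairs contribute γ²∬F minus γ² times the integral of F over the blocks C×C, one for each cell C. By
stationarity the expected indicator that x and y share a cell is κ(y-x), where κ(z) = P(z ∈ V₀) is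
`coverProb`. Hence α_Γ = γδ₀ + γ²λ - γ²κλ (`lintegral_tsum_tsum`, `reducedSecondMoment_add`). This
is stated additively, since all terms live in `ℝ≥0∞`.

Fairness gives ∫κ = E λ(V₀) = γ⁻¹ (`lintegral_coverProb`). So β_Γ = γδ₀ - γ²κλ is a finite signed
measure of total mass zero. The variance of Γ(B) therefore reduces to γ²∫κ(z) λ(B \ (B-z)) dz
(`variance_pointMeasure`), which is o(λ(B)) for large balls by dominated convergence. This is
hyperuniformity.

Plancherel turns the formula for β_Γ into S_Γ = 1 - γκ̂. It remains to see that κ̂(k) = γ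
E|1̂_{V₀}(k)|². Fubini gives κ̂(k) = E 1̂_{V₀}(k). In |1̂_{V₀}(k)|² one factor is an integral over y
∈ V₀ of a phase, and that phase turns the other factor into the transform of the zero cell seen from
y. Exchanging the roles of 0 and y (mass transport) then yields γ⁻¹ E 1̂_{V₀}(k)
(`integral_indicatorFourierSq_zeroCell`). The Palm formula follows in the same spirit, by spreading
each centre uniformly over its cell. -/

/-! ### Plancherel's theorem -/

open scoped FourierTransform SchwartzMap in
/-- On `L¹ ∩ L²` the Fourier transform on `L²` is given by the Fourier integral. -/
theorem MeasureTheory.MemLp.fourier_toLp_ae_eq {V : Type*} [NormedAddCommGroup V]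
    [InnerProductSpace ℝ V] [FiniteDimensional ℝ V] [MeasurableSpace V] [BorelSpace V]
    {f : V → ℂ} (h1 : Integrable f) (h2 : MemLp f 2) :
    (𝓕 (h2.toLp f) : Lp ℂ 2 (volume : Measure V)) =ᵐ[volume] 𝓕 f := by
  have hcont : Continuous (𝓕 f) :=
    VectorFourier.fourierIntegral_continuous Real.continuous_fourierChar
      (by exact continuous_inner) h1
  refine ae_eq_of_integral_contDiff_smul_eq
    ((Lp.memLp (𝓕 (h2.toLp f))).locallyIntegrable (by norm_num)) hcont.locallyIntegrable ?_
  intro g hg hgs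
  have hgs' : HasCompactSupport (fun x => (g x : ℂ)) := hgs.comp_left (g := ((↑) : ℝ → ℂ)) (by simp)
  have hg' : ContDiff ℝ (⊤ : ℕ∞) (fun x => (g x : ℂ)) := Complex.ofRealCLM.contDiff.comp hg
  let G : 𝓢(V, ℂ) := hgs'.toSchwartzMap hg'
  -- As a tempered distribution, the L² transform is defined by moving 𝓕 onto the test function. The
  -- Fourier integral has the same duality by Fubini.
  have key := congrArg (fun T => T G) (Lp.fourier_toTemperedDistribution_eq (h2.toLp f))
  simp only [TemperedDistribution.fourier_apply, Lp.toTemperedDistribution_apply] at key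
  have e1 : ∫ x, (𝓕 G) x • (h2.toLp f : V → ℂ) x = ∫ x, (𝓕 G) x • f x :=
    integral_congr_ae (by filter_upwards [h2.coeFn_toLp] with x hx; rw [hx])
  rw [e1] at key
  have e2 := VectorFourier.integral_fourierIntegral_smul_eq_flip (L := innerₗ V) (μ := volume)
    (ν := volume) Real.continuous_fourierChar (by exact continuous_inner) G.integrable h1
  rw [flip_innerₗ] at e2
  have e3 : ∀ x, g x • (𝓕 (h2.toLp f) : Lp ℂ 2 (volume : Measure V)) x
      = G x • (𝓕 (h2.toLp f) : Lp ℂ 2 (volume : Measure V)) x := fun x => by simp [G]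
  have e4 : ∀ x, g x • 𝓕 f x = G x • 𝓕 f x := fun x => by simp [G]
  simp_rw [e3, e4]
  rw [← key]
  exact e2

open scoped FourierTransform in
/-- Plancherel's theorem for functions in `L¹ ∩ L²`. -/
theorem Real.plancherel_of_integrable {V : Type*} [NormedAddCommGroup V]
    [InnerProductSpace ℝ V] [FiniteDimensional ℝ V] [MeasurableSpace V] [BorelSpace V]
    {f g : V → ℂ} (hf : Integrable f) (hf2 : MemLp f 2) (hg : Integrable g) (hg2 : MemLp g 2) :
    Integrable (fun k => 𝓕 f k * (starRingEnd ℂ) (𝓕 g k)) ∧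
      ∫ k, 𝓕 f k * (starRingEnd ℂ) (𝓕 g k) = ∫ x, f x * (starRingEnd ℂ) (g x) := by
  have h1 := hf2.fourier_toLp_ae_eq hf
  have h2 := hg2.fourier_toLp_ae_eq hg
  have key := Lp.inner_fourier_eq (hg2.toLp g) (hf2.toLp f)
  have hint := L2.integrable_inner (𝕜 := ℂ) (𝓕 (hg2.toLp g)) (𝓕 (hf2.toLp f))
  simp only [L2.inner_def] at key
  have e1 : (fun k => inner ℂ ((𝓕 (hg2.toLp g) : Lp ℂ 2 (volume : Measure V)) k)
      ((𝓕 (hf2.toLp f) : Lp ℂ 2 (volume : Measure V)) k))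
      =ᵐ[volume] fun k => 𝓕 f k * (starRingEnd ℂ) (𝓕 g k) := by
    filter_upwards [h1, h2] with k hk1 hk2
    rw [hk1, hk2]; rfl
  refine ⟨hint.congr e1, ?_⟩
  rw [← integral_congr_ae e1, key]
  refine integral_congr_ae ?_
  filter_upwards [hf2.coeFn_toLp, hg2.coeFn_toLp] with k hk1 hk2
  rw [hk1, hk2]; rfl

namespace RandomMeasures

variable {d : ℕ}

open scoped FourierTransform in
theorem fourierTr_eq (f : Space d → ℝ) (k : Space d) :
    fourierTr f k = 𝓕 (fun x => (f x : ℂ)) ((2 * Real.pi)⁻¹ • k) := by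
  rw [fourierTr, Real.fourier_eq']
  refine integral_congr_ae (ae_of_all _ fun x => ?_)
  simp only [inner_smul_right, smul_eq_mul]
  rw [mul_comm, real_inner_comm]
  congr 2
  have : (Real.pi : ℂ) ≠ 0 := by exact_mod_cast Real.pi_ne_zero
  push_cast
  field_simp

theorem memLp_two_of_bounded {f : Space d → ℝ} (hf : Integrable f) {c : ℝ} (hc : ∀ x, |f x| ≤ c) :
    MemLp f 2 := by
  rw [memLp_two_iff_integrable_sq hf.aestronglyMeasurable]
  simp_rw [sq]
  exact hf.bdd_mul hf.aestronglyMeasurable (ae_of_all _ hc)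

/-- The factor (2π)^{-d} is the Jacobian of k ↦ k/(2π), which relates the two normalizations of the
Fourier transform. -/
theorem plancherel_fourierTr {f g : Space d → ℝ} (hf : Integrable f) (hf2 : MemLp f 2)
    (hg : Integrable g) (hg2 : MemLp g 2) :
    Integrable (fun k => fourierTr f k * (starRingEnd ℂ) (fourierTr g k)) ∧
      ((∫ x, f x * g x : ℝ) : ℂ) = (((2 * Real.pi) ^ d)⁻¹ : ℝ) *
        ∫ k, fourierTr f k * (starRingEnd ℂ) (fourierTr g k) := by
  obtain ⟨h1, h2⟩ := Real.plancherel_of_integrable hf.ofReal hf2.ofReal hg.ofReal hg2.ofReal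
  simp_rw [fourierTr_eq]
  have hpi : (2 * Real.pi) ≠ 0 := by positivity
  refine ⟨(integrable_comp_smul_iff volume _ (inv_ne_zero hpi)).2 h1, ?_⟩
  have h3 := Measure.integral_comp_inv_smul (volume : Measure (Space d)) (fun k =>
    (FourierTransform.fourier (fun x => (f x : ℂ)) k) *
      (starRingEnd ℂ) (FourierTransform.fourier (fun x => (g x : ℂ)) k)) (2 * Real.pi)
  rw [h3]
  erw [h2]
  rw [finrank_euclideanSpace_fin, abs_of_pos (by positivity), Complex.real_smul, ← mul_assoc,
    ← Complex.ofReal_mul, inv_mul_cancel₀ (by positivity), Complex.ofReal_one, one_mul,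
    ← integral_complex_ofReal]
  simp

end RandomMeasures

/-! ### Mixtures of product measures and measurability of the partition -/

namespace RandomMeasures

section InfiniteProduct

theorem measurable_infinitePi {α E : Type*} [MeasurableSpace α] [MeasurableSpace E]
    {p : ℕ → α → Measure E} [∀ n a, IsProbabilityMeasure (p n a)] (hp : ∀ n, Measurable (p n)) :
    Measurable fun a => Measure.infinitePi fun n => p n a := by
  refine Measurable.measure_of_isPiSystem_of_isProbabilityMeasure
    (generateFrom_squareCylinders (α := fun _ : ℕ => E)).symm
    (isPiSystem_squareCylinders (fun _ => MeasurableSpace.isPiSystem_measurableSet)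
      (fun _ => MeasurableSet.univ)) ?_
  intro S hS
  obtain ⟨s, t, ht, rfl⟩ := hS
  replace ht : ∀ n, MeasurableSet (t n) := fun n => ht n (Set.mem_univ n)
  simp_rw [Measure.infinitePi_pi (fun n => p n _) (fun n _ => ht n)]
  exact Finset.measurable_fun_prod _ fun n _ => (Measure.measurable_coe (ht n)).comp (hp n)

/-- Both sides are probability measures that agree on the π-system of cylinders. This turns averaged
finite-dimensional identities into a law on the whole sequence space. -/
theorem map_eq_bind_infinitePi {α E : Type*} [MeasurableSpace α] [MeasurableSpace E]
    {P : Measure α} [IsProbabilityMeasure P]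
    {p : ℕ → α → Measure E} [∀ n a, IsProbabilityMeasure (p n a)] (hp : ∀ n, Measurable (p n))
    {ζ : α → ℕ → E} (hζ : AEMeasurable ζ P)
    (h : ∀ (s : Finset ℕ) (A : ℕ → Set E), (∀ n, MeasurableSet (A n)) →
      P {a | ∀ n ∈ s, ζ a n ∈ A n} = ∫⁻ a, ∏ n ∈ s, p n a (A n) ∂P) :
    P.map ζ = P.bind fun a => Measure.infinitePi fun n => p n a := by
  have hm := (measurable_infinitePi hp).aemeasurable (μ := P)
  have : IsProbabilityMeasure (P.map ζ) := Measure.isProbabilityMeasure_map hζ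
  refine MeasureTheory.ext_of_generate_finite _
    (generateFrom_squareCylinders (α := fun _ : ℕ => E)).symm
    (isPiSystem_squareCylinders (fun _ => MeasurableSpace.isPiSystem_measurableSet)
      (fun _ => MeasurableSet.univ)) ?_ ?_
  · intro S hS
    obtain ⟨s, t, ht, rfl⟩ := hS
    replace ht : ∀ n, MeasurableSet (t n) := fun n => ht n (Set.mem_univ n)
    have hS : MeasurableSet ((s : Set ℕ).pi t) := .pi s.countable_toSet fun n _ => ht n
    rw [Measure.map_apply_of_aemeasurable hζ hS, Measure.bind_apply hS hm]
    simp_rw [Measure.infinitePi_pi (fun n => p n _) (fun n _ => ht n)]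
    rw [← h s t ht]
    rfl
  · rw [Measure.bind_apply .univ hm]
    simp

end InfiniteProduct

section Uniform

variable {d : ℕ}

open Classical in
/-- The uniform distribution on a set of positive and finite volume
(and a point mass for all other sets). -/
noncomputable def uniformLaw (C : Set (Space d)) : Measure (Space d) :=
  if volume C ≠ 0 ∧ volume C ≠ ∞ then cond volume C else Measure.dirac 0

instance (C : Set (Space d)) : IsProbabilityMeasure (uniformLaw C) := by
  unfold uniformLaw
  split_ifs with h
  · exact cond_isProbabilityMeasure_of_finite h.1 h.2
  · infer_instance

end Uniform

variable {Ω : Type*} [MeasurableSpace Ω] {d : ℕ} [AddAction (Space d) Ω]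
  {P : Measure Ω} {Ψ : Ω → Measure (Space d)} {τ : Ω → Space d → Option (Space d)}

namespace IsInvariantPartition

theorem measurableSet_isSome (h : IsInvariantPartition P Ψ τ) :
    MeasurableSet {p : Ω × Space d | (τ p.1 p.2).isSome} := by
  convert! h.measurable_allocation Set.univ .univ using 1
  ext p
  simp [Option.isSome_iff_exists]

/-- Together with `measurableSet_isSome` this encodes the allocation by a measurable set and a
Euclidean-valued map. Later measurability arguments can then avoid `Option`. -/
theorem measurable_getD (h : IsInvariantPartition P Ψ τ) :
    Measurable fun p : Ω × Space d => (τ p.1 p.2).getD 0 := by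
  intro B hB
  have : (fun p : Ω × Space d => (τ p.1 p.2).getD 0) ⁻¹' B
      = {p | ∃ z ∈ B, τ p.1 p.2 = some z} ∪ ({p | (τ p.1 p.2).isSome}ᶜ ∩ {_p | (0 : Space d) ∈ B}) := by
    ext p
    rcases hp : τ p.1 p.2 with _ | z <;> simp [hp]
  rw [this]
  exact (h.measurable_allocation B hB).union (h.measurableSet_isSome.compl.inter (.const _))

theorem measurableSet_eq_some (h : IsInvariantPartition P Ψ τ) {β : Type*} [MeasurableSpace β]
    {f : β → Ω} {u v : β → Space d} (hf : Measurable f) (hu : Measurable u) (hv : Measurable v) :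
    MeasurableSet {b | τ (f b) (u b) = some (v b)} := by
  have : {b | τ (f b) (u b) = some (v b)} =
      (fun b => (f b, u b)) ⁻¹' {p : Ω × Space d | (τ p.1 p.2).isSome} ∩
        {b | (τ (f b) (u b)).getD 0 = v b} := by
    ext b
    rcases hp : τ (f b) (u b) with _ | z <;> simp [hp]
  rw [this]
  exact ((hf.prodMk hu) h.measurableSet_isSome).inter
    (measurableSet_eq_fun (h.measurable_getD.comp (hf.prodMk hu)) hv)

theorem measurableSet_eq (h : IsInvariantPartition P Ψ τ) {β : Type*} [MeasurableSpace β]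
    {f : β → Ω} {u v : β → Space d} (hf : Measurable f) (hu : Measurable u) (hv : Measurable v) :
    MeasurableSet {b | τ (f b) (u b) = τ (f b) (v b)} := by
  have hs {w : β → Space d} (hw : Measurable w) : MeasurableSet {b | (τ (f b) (w b)).isSome} :=
    (hf.prodMk hw) h.measurableSet_isSome
  have hg {w : β → Space d} (hw : Measurable w) : Measurable fun b => (τ (f b) (w b)).getD 0 :=
    h.measurable_getD.comp (hf.prodMk hw)
  have : {b | τ (f b) (u b) = τ (f b) (v b)} =
      ({b | (τ (f b) (u b)).isSome} ∩ {b | τ (f b) (u b) = some ((τ (f b) (v b)).getD 0)} ∩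
        {b | (τ (f b) (v b)).isSome}) ∪
      ({b | (τ (f b) (u b)).isSome}ᶜ ∩ {b | (τ (f b) (v b)).isSome}ᶜ) := by
    ext b
    rcases hp : τ (f b) (u b) with _ | z <;> rcases hq : τ (f b) (v b) with _ | z' <;> simp [hp, hq]
  rw [this]
  exact (((hs hu).inter (h.measurableSet_eq_some hf hu (hg hv))).inter (hs hv)).union
    ((hs hu).compl.inter (hs hv).compl)

theorem measurableSet_cell (h : IsInvariantPartition P Ψ τ) (ω : Ω) (x : Space d) :
    MeasurableSet (cell τ ω x) :=
  h.measurableSet_eq_some measurable_const measurable_id measurable_const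

theorem measurableSet_zeroCell (h : IsInvariantPartition P Ψ τ) (ω : Ω) :
    MeasurableSet (zeroCell τ ω) :=
  h.measurableSet_eq measurable_const measurable_id measurable_const

theorem ae_ne_zero (h : IsInvariantPartition P Ψ τ) : ∀ᵐ ω ∂P, Ψ ω ≠ 0 := by
  filter_upwards [h.nonzero] with ω hω h0
  simp [h0] at hω

theorem countable_points (h : IsInvariantPartition P Ψ τ) (ω : Ω) : (points (Ψ ω)).Countable := by
  have := h.locallyFinite ω
  have := Measure.countable_meas_pos_of_disjoint_iUnion (μ := Ψ ω)
    (As := fun x : Space d => {x}) (fun x => measurableSet_singleton x)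
    (fun x y hxy => by simpa using hxy)
  simpa only [pos_iff_ne_zero, points] using this

/-- If Ψ has points, every y lies in exactly one cell, so the sum over the random index set
collapses to one volume. This form is visibly measurable in ω. For Ψ = 0 the sum is empty, hence the
indicator. -/
theorem transport_apply (h : IsInvariantPartition P Ψ τ) (ω : Ω) {S : Set (Space d × Space d)}
    (hS : MeasurableSet S) :
    transport Ψ τ ω S = {ω | Ψ ω ≠ 0}.indicator
      (fun ω => volume {y | (τ ω y).isSome ∧ ((τ ω y).getD 0, y) ∈ S}) ω := by
  have hc : Countable (points (Ψ ω)) := (h.countable_points ω).to_subtype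
  rw [transport, Measure.sum_apply _ hS]
  have h1 (x : points (Ψ ω)) : ((Measure.dirac (x : Space d)).prod
      (volume.restrict (cell τ ω x))) S = volume ({y | ((x : Space d), y) ∈ S} ∩ cell τ ω x) := by
    rw [Measure.dirac_prod, Measure.map_apply (by fun_prop) hS,
      Measure.restrict_apply (measurable_prodMk_left hS)]
    rfl
  simp_rw [h1]
  by_cases h0 : Ψ ω = 0
  · have : IsEmpty (points (Ψ ω)) := by simp [points, h0]
    simp [h0]
  rw [Set.indicator_of_mem (by exact h0), ← measure_iUnion]
  · congr 1
    ext y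
    obtain ⟨z, hz, hy⟩ := h.allocation_mem ω h0 y
    simp only [Set.mem_iUnion, Set.mem_inter_iff, Set.mem_ofPred_eq, cell, hy, Option.some.injEq,
      Option.isSome_some, Option.getD_some, true_and]
    constructor
    · rintro ⟨x, hx, rfl⟩; exact hx
    · intro hyS; exact ⟨⟨z, hz⟩, hyS, rfl⟩
  · intro x x' hx
    refine Set.disjoint_left.2 fun y hy hy' => hx ?_
    have := hy.2.symm.trans hy'.2
    simpa [Subtype.ext_iff] using this
  · exact fun x => (measurable_prodMk_left hS).inter (h.measurableSet_cell ω x)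

theorem measurable_transport (h : IsInvariantPartition P Ψ τ) : Measurable (transport Ψ τ) := by
  refine Measure.measurable_of_measurable_coe _ fun S hS => ?_
  simp_rw [h.transport_apply _ hS]
  refine Measurable.indicator ?_ ?_
  · refine measurable_measure_prodMk_left (s := {p : Ω × Space d | (τ p.1 p.2).isSome ∧
      ((τ p.1 p.2).getD 0, p.2) ∈ S}) ?_
    exact h.measurableSet_isSome.inter ((h.measurable_getD.prodMk measurable_snd) hS)
  · have : {ω | Ψ ω ≠ 0} = {ω | Ψ ω Set.univ = 0}ᶜ := by ext; simp
    rw [this]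
    exact (((Measure.measurable_coe .univ).comp h.measurable) (measurableSet_singleton 0)).compl

theorem transportSigma_le (h : IsInvariantPartition P Ψ τ) :
    transportSigma Ψ τ ≤ ‹MeasurableSpace Ω› :=
  h.measurable_transport.comap_le

theorem measurable_uniformLaw (h : IsInvariantPartition P Ψ τ) {X : Ω → Space d}
    (hX : Measurable X) : Measurable fun ω => uniformLaw (cell τ ω (X ω)) := by
  have hv {B : Set (Space d)} (hB : MeasurableSet B) :
      Measurable fun ω => volume (cell τ ω (X ω) ∩ B) := by
    refine measurable_measure_prodMk_left
      (s := {p : Ω × Space d | τ p.1 p.2 = some (X p.1)} ∩ Prod.snd ⁻¹' B) ?_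
    exact (h.measurableSet_eq_some measurable_fst measurable_snd (hX.comp measurable_fst)).inter
      (measurable_snd hB)
  have hv' : Measurable fun ω => volume (cell τ ω (X ω)) := by simpa using hv .univ
  refine Measure.measurable_of_measurable_coe _ fun B hB => ?_
  have : (fun ω => uniformLaw (cell τ ω (X ω)) B) = fun ω =>
      if ω ∈ {ω | volume (cell τ ω (X ω)) ≠ 0 ∧ volume (cell τ ω (X ω)) ≠ ∞} then
        (volume (cell τ ω (X ω)))⁻¹ * volume (cell τ ω (X ω) ∩ B) else Measure.dirac 0 B := by
    funext ω
    simp only [uniformLaw, Set.mem_ofPred_eq]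
    split_ifs
    · rw [cond_apply (h.measurableSet_cell _ _)]
    · rfl
  rw [this]
  exact Measurable.ite ((hv' (measurableSet_singleton 0)).compl.inter
    (hv' (measurableSet_singleton ∞)).compl) (hv'.inv.mul (hv hB)) measurable_const

variable [MeasurableVAdd₂ (Space d) Ω] [VAddInvariantMeasure (Space d) Ω P]

theorem lintegral_vadd (x : Space d) (f : Ω → ℝ≥0∞) : ∫⁻ ω, f (x +ᵥ ω) ∂P = ∫⁻ ω, f ω ∂P := by
  exact (measurePreserving_vadd x P).lintegral_comp_emb (measurableEmbedding_const_vadd x) f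

end IsInvariantPartition

theorem shiftMeasure_apply (x : Space d) (φ : Measure (Space d)) {B : Set (Space d)}
    (hB : MeasurableSet B) : shiftMeasure x φ B = φ ((fun y => y - x) ⁻¹' B) :=
  Measure.map_apply (measurable_sub_const x) hB

theorem measurableSet_unitCube : MeasurableSet (unitCube d) := by
  have : unitCube d = ⋂ i, (fun x : Space d => x i) ⁻¹' Set.Icc 0 1 := by
    ext; simp [unitCube]
  rw [this]
  exact .iInter fun i => (by fun_prop : Measurable fun x : Space d => x i) measurableSet_Icc

theorem volume_unitCube : volume (unitCube d) = 1 := by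
  have h := (EuclideanSpace.volume_preserving_symm_measurableEquiv_toLp (Fin d))
  have : unitCube d = (MeasurableEquiv.toLp 2 (Fin d → ℝ)).symm ⁻¹'
      (Set.univ.pi fun _ => Set.Icc 0 1) := by
    ext; simp [unitCube, Pi.le_def, forall_and]
  rw [this, h.measure_preimage_equiv, volume_pi_pi]
  simp

namespace IsInvariantPartition
variable [MeasurableVAdd₂ (Space d) Ω] [VAddInvariantMeasure (Space d) Ω P]

/-- With zero intensity each translated unit cube is almost surely empty. Countably many translates
cover space, which contradicts Ψ ≠ 0. -/
theorem intensity_ne_zero [NeZero P] (h : IsInvariantPartition P Ψ τ) : intensity P Ψ ≠ 0 := by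
  intro h0
  have h1 (x : Space d) : ∀ᵐ ω ∂P, Ψ ω ((fun y => y - x) ⁻¹' unitCube d) = 0 := by
    have : ∫⁻ ω, Ψ ω ((fun y => y - x) ⁻¹' unitCube d) ∂P = 0 := by
      rw [← h0, intensity, ← lintegral_vadd x fun ω => Ψ ω (unitCube d)]
      refine lintegral_congr fun ω => ?_
      rw [h.invariant, shiftMeasure_apply _ _ measurableSet_unitCube]
    rwa [lintegral_eq_zero_iff] at this
    exact (Measure.measurable_coe (measurableSet_unitCube.preimage (by fun_prop))).comp h.measurable
  have h2 : ∀ᵐ ω ∂P, ∀ n, Ψ ω ((fun y => y - TopologicalSpace.denseSeq (Space d) n) ⁻¹' unitCube d)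
      = 0 := ae_all_iff.2 fun n => h1 _
  have h3 : ∀ᵐ ω ∂P, False := by
    filter_upwards [h2, h.nonzero] with ω h2 hn
    apply hn
    refine measure_mono_null ?_ (measure_iUnion_null h2)
    intro y _
    -- The translation vectors that put y in the interior of the cube form a nonempty open set, so
    -- the dense sequence meets it.
    have ho : IsOpen {x : Space d | ∀ i, y i - x i ∈ Set.Ioo (0 : ℝ) 1} := by
      simp only [Set.ofPred_forall]
      refine isOpen_iInter_of_finite fun i => ?_
      exact isOpen_Ioo.preimage (by fun_prop)
    obtain ⟨n, hn⟩ := (TopologicalSpace.denseRange_denseSeq (Space d)).exists_mem_open ho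
      ⟨WithLp.toLp 2 fun i => y i - 1 / 2, by intro i; simp; norm_num⟩
    exact Set.mem_iUnion.2 ⟨n, fun i => Set.Ioo_subset_Icc_self (hn i)⟩
  exact NeZero.ne P (by simpa using h3)

end IsInvariantPartition
end RandomMeasures

/-! ### The conditional law of the displaced points -/

namespace RandomMeasures

variable {Ω : Type*} [MeasurableSpace Ω] {d : ℕ}
  {P : Measure Ω} {Ψ : Ω → Measure (Space d)} {τ : Ω → Space d → Option (Space d)}

theorem IsFair.uniformLaw_eq (hf : IsFair P Ψ τ) (h0 : intensity P Ψ ≠ 0)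
    (h1 : intensity P Ψ ≠ ∞) :
    ∀ᵐ ω ∂P, ∀ x ∈ points (Ψ ω), uniformLaw (cell τ ω x) = cond volume (cell τ ω x) ∧
      uniformLaw (cell τ ω x) = intensity P Ψ • volume.restrict (cell τ ω x) := by
  filter_upwards [hf] with ω hω x hx
  have hv := hω x hx
  have : uniformLaw (cell τ ω x) = cond volume (cell τ ω x) := by
    rw [uniformLaw, if_pos]
    rw [hv]
    exact ⟨ENNReal.inv_ne_zero.2 h1, ENNReal.inv_ne_top.2 h0⟩
  refine ⟨this, ?_⟩
  rw [this, ProbabilityTheory.cond, hv, inv_inv]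

/-- `X` is an enumeration of the points of `Ψ` without repetitions. -/
structure IsEnumeration (P : Measure Ω) (Ψ : Ω → Measure (Space d)) (X : ℕ → Ω → Space d) :
    Prop where
  measurable : ∀ n, Measurable (X n)
  injective : ∀ᵐ ω ∂P, Function.Injective fun n => X n ω
  range_eq : ∀ᵐ ω ∂P, Set.range (fun n => X n ω) = points (Ψ ω)

variable [AddAction (Space d) Ω]

/-- Given `T`, the vectors `Z(x)`, `x ∈ Ψ`, have the product of the uniform distributions on the
cells as their conditional law. -/
theorem IsConditionallyUniform.exists_law [IsProbabilityMeasure P]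
    {Z : Ω → Space d → Space d}
    (hZ : IsConditionallyUniform P Ψ τ Z) (h : IsInvariantPartition P Ψ τ) (hf : IsFair P Ψ τ)
    (h0 : intensity P Ψ ≠ 0) :
    ∃ X : ℕ → Ω → Space d, IsEnumeration P Ψ X ∧ AEMeasurable (fun ω n => Z ω (X n ω)) P ∧
      P.map (fun ω n => Z ω (X n ω)) =
        P.bind fun ω => Measure.infinitePi fun n => uniformLaw (cell τ ω (X n ω)) := by
  obtain ⟨X, hX, henum, hZm, hdist, hind⟩ := hZ
  have hm := h.transportSigma_le
  have hX' : ∀ n, Measurable (X n) := fun n => (hX n).mono hm le_rfl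
  have hZm' : AEMeasurable (fun ω n => Z ω (X n ω)) P := aemeasurable_pi_iff.2 hZm
  refine ⟨X, ⟨hX', henum.mono fun _ h => h.1, henum.mono fun _ h => h.2⟩, hZm', ?_⟩
  refine map_eq_bind_infinitePi (fun n => h.measurable_uniformLaw (hX' n)) hZm' ?_
  intro s A hA
  have hS : NullMeasurableSet {ω | ∀ n ∈ s, Z ω (X n ω) ∈ A n} P := by
    have : {ω | ∀ n ∈ s, Z ω (X n ω) ∈ A n}
        = (fun ω n => Z ω (X n ω)) ⁻¹' ((s : Set ℕ).pi A) := rfl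
    rw [this]
    exact hZm'.nullMeasurableSet_preimage (.pi s.countable_toSet fun n _ => hA n)
  -- From here on only the averaged law matters: integrating the conditional expectation gives the
  -- cylinder probabilities.
  have e1 : ∫ ω, (P[{ω | ∀ n ∈ s, Z ω (X n ω) ∈ A n}.indicator (fun _ => (1 : ℝ)) |
      transportSigma Ψ τ]) ω ∂P = P.real {ω | ∀ n ∈ s, Z ω (X n ω) ∈ A n} := by
    rw [integral_condExp hm, integral_indicator₀ hS]
    simp
  have e2 : P[{ω | ∀ n ∈ s, Z ω (X n ω) ∈ A n}.indicator (fun _ => (1 : ℝ)) |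
      transportSigma Ψ τ] =ᵐ[P]
      fun ω => ∏ n ∈ s, (uniformLaw (cell τ ω (X n ω))).real (A n) := by
    have hd : ∀ᵐ ω ∂P, ∀ n, (P[{ω | Z ω (X n ω) ∈ A n}.indicator (fun _ => (1 : ℝ)) |
        transportSigma Ψ τ]) ω = (ProbabilityTheory.cond volume (cell τ ω (X n ω))).real (A n) :=
      ae_all_iff.2 fun n => hdist n (A n) (hA n)
    filter_upwards [hind s A hA, hd, henum, hf.uniformLaw_eq h0 h.intensity_ne_top]
      with ω h1 h2 h3 h4
    rw [h1]
    refine Finset.prod_congr rfl fun n _ => ?_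
    rw [h2, (h4 (X n ω) (h3.2 ▸ Set.mem_range_self n)).1]
  rw [integral_congr_ae e2] at e1
  rw [← ENNReal.ofReal_toReal (measure_ne_top P _), ← measureReal_def, ← e1,
    integral_eq_lintegral_of_nonneg_ae, ENNReal.ofReal_toReal]
  · refine lintegral_congr fun ω => ?_
    rw [ENNReal.ofReal_prod_of_nonneg fun _ _ => measureReal_nonneg]
    simp
  · refine ne_top_of_le_ne_top (b := 1) ENNReal.one_ne_top ?_
    calc _ ≤ ∫⁻ ω, 1 ∂P := lintegral_mono fun ω => by
          rw [ENNReal.ofReal_le_one]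
          exact Finset.prod_le_one (fun _ _ => measureReal_nonneg) fun _ _ => measureReal_le_one
      _ = 1 := by simp
  · exact ae_of_all _ fun ω => Finset.prod_nonneg fun _ _ => measureReal_nonneg
  · refine (Finset.measurable_fun_prod _ fun n _ => ?_).aestronglyMeasurable
    exact ((Measure.measurable_coe (hA n)).comp (h.measurable_uniformLaw (hX' n))).ennreal_toReal

end RandomMeasures

/-! ### Point measures and enumerations -/

namespace RandomMeasures

section PointMeasure

variable {E : Type*} [MeasurableSpace E]

/-- The measure `∑ₙ δ_{zₙ}`. -/
noncomputable def pointMeasure (z : ℕ → E) : Measure E :=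
  Measure.sum fun n => Measure.dirac (z n)

instance (z : ℕ → E) : SFinite (pointMeasure z) := by unfold pointMeasure; infer_instance

theorem lintegral_pointMeasure (z : ℕ → E) {f : E → ℝ≥0∞} (hf : Measurable f) :
    ∫⁻ x, f x ∂pointMeasure z = ∑' n, f (z n) := by
  simp [pointMeasure, lintegral_sum_measure, lintegral_dirac' _ hf]

theorem pointMeasure_apply (z : ℕ → E) {B : Set E} (hB : MeasurableSet B) :
    pointMeasure z B = ∑' n, B.indicator 1 (z n) := by
  simp [pointMeasure, Measure.sum_apply _ hB, Measure.dirac_apply' _ hB]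

theorem measurable_pointMeasure : Measurable (pointMeasure : (ℕ → E) → Measure E) := by
  refine Measure.measurable_of_measurable_coe _ fun B hB => ?_
  simp_rw [pointMeasure_apply _ hB]
  exact .tsum fun n => (measurable_one.indicator hB).comp (measurable_pi_apply n)

theorem pointMeasure_comp_equiv (z : ℕ → E) (σ : ℕ ≃ ℕ) :
    pointMeasure (fun n => z (σ n)) = pointMeasure z :=
  Measure.sum_comp_equiv σ fun n => Measure.dirac (z n)

theorem pointMeasure_apply_eq_encard (z : ℕ → E) {B : Set E} (hB : MeasurableSet B) :
    pointMeasure z B = ((z ⁻¹' B).encard : ℝ≥0∞) := by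
  rw [pointMeasure_apply z hB, ← Measure.count_apply (by measurability), ← lintegral_indicator_one
    (by measurability), lintegral_count]
  rfl

end PointMeasure

variable {d : ℕ}

theorem isIntegerValued_pointMeasure (z : ℕ → Space d) : IsIntegerValued (pointMeasure z) :=
  fun _ hB => ⟨_, pointMeasure_apply_eq_encard z hB⟩

theorem shiftMeasure_pointMeasure (x : Space d) (z : ℕ → Space d) :
    shiftMeasure x (pointMeasure z) = pointMeasure fun n => z n - x := by
  have hm : Measurable fun y : Space d => y - x := measurable_sub_const x
  rw [shiftMeasure, pointMeasure, Measure.map_sum hm.aemeasurable]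
  simp [pointMeasure, Measure.map_dirac' hm]

/-- An integer valued locally finite measure is concentrated on its atoms. -/
theorem IsIntegerValued.measure_compl_points {φ : Measure (Space d)} [IsLocallyFiniteMeasure φ]
    (hφ : IsIntegerValued φ) : φ (points φ)ᶜ = 0 := by
  refine measure_null_of_locally_null _ fun x _ => ?_
  -- Punctured balls shrink to the empty set, so their masses tend to 0. An integer mass below 1
  -- vanishes.
  obtain ⟨r, hr, hr'⟩ : ∃ r > 0, φ (Metric.closedBall x r \ {x}) = 0 := by
    have hanti : Antitone fun n : ℕ => Metric.closedBall x (1 / (n + 1 : ℝ)) \ {x} := by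
      intro m n hmn
      refine Set.sdiff_subset_sdiff_left (Metric.closedBall_subset_closedBall ?_)
      exact one_div_le_one_div_of_le (by positivity) (by exact_mod_cast Nat.succ_le_succ hmn)
    have hms (n : ℕ) : MeasurableSet (Metric.closedBall x (1 / (n + 1 : ℝ)) \ {x}) :=
      Metric.isClosed_closedBall.measurableSet.diff (measurableSet_singleton x)
    have hlim := tendsto_measure_iInter_atTop (μ := φ) (fun n => (hms n).nullMeasurableSet) hanti
      ⟨0, ne_top_of_le_ne_top ((isCompact_closedBall x _).measure_lt_top.ne)
        (measure_mono Set.sdiff_subset)⟩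
    have hempty : ⋂ n : ℕ, Metric.closedBall x (1 / (n + 1 : ℝ)) \ {x} = ∅ := by
      refine Set.eq_empty_of_forall_notMem fun y hy => ?_
      rw [Set.mem_iInter] at hy
      have hd : dist y x ≤ 0 := ge_of_tendsto' tendsto_one_div_add_atTop_nhds_zero_nat
        fun n => (hy n).1
      exact (hy 0).2 (dist_le_zero.1 hd)
    rw [hempty, measure_empty] at hlim
    obtain ⟨n, hn⟩ := (hlim.eventually (gt_mem_nhds (zero_lt_one' ℝ≥0∞))).exists
    refine ⟨1 / (n + 1), by positivity, ?_⟩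
    obtain ⟨k, hk⟩ := hφ _ (hms n)
    rw [Function.comp_apply, hk] at hn
    rw [hk]
    have : k < 1 := by exact_mod_cast hn
    simpa using this
  refine ⟨_, inter_mem_nhdsWithin _ (Metric.closedBall_mem_nhds x hr), ?_⟩
  by_cases hx : φ {x} = 0
  · refine measure_mono_null ?_ (measure_union_null hx hr')
    rintro y ⟨-, hy⟩
    by_cases hyx : y = x
    · exact .inl hyx
    · exact .inr ⟨hy, hyx⟩
  · refine measure_mono_null ?_ hr'
    rintro y ⟨hy1, hy⟩
    exact ⟨hy, fun hyx => hy1 (by rw [Set.mem_singleton_iff.1 hyx]; exact hx)⟩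

theorem eq_pointMeasure {φ : Measure (Space d)} [IsLocallyFiniteMeasure φ]
    (hφ : IsIntegerValued φ) (hs : ∀ x, φ {x} = 0 ∨ φ {x} = 1) {X : ℕ → Space d}
    (hX : Function.Injective X) (hX' : Set.range X = points φ) : φ = pointMeasure X := by
  ext B hB
  rw [pointMeasure_apply X hB]
  have h1 : φ B = φ (⋃ n, B ∩ {X n}) := by
    refine le_antisymm ?_ (measure_mono (by simp))
    calc φ B ≤ φ ((⋃ n, B ∩ {X n}) ∪ (points φ)ᶜ) := by
          refine measure_mono fun y hy => ?_
          by_cases hyp : y ∈ points φ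
          · obtain ⟨n, rfl⟩ := hX' ▸ hyp
            exact .inl (Set.mem_iUnion.2 ⟨n, hy, rfl⟩)
          · exact .inr hyp
      _ ≤ _ := by
          refine (measure_union_le _ _).trans ?_
          rw [hφ.measure_compl_points, add_zero]
  rw [h1, measure_iUnion]
  · refine tsum_congr fun n => ?_
    by_cases hn : X n ∈ B
    · rw [Set.inter_eq_self_of_subset_right (by simpa using hn), Set.indicator_of_mem hn]
      have : X n ∈ points φ := hX' ▸ Set.mem_range_self n
      exact (hs _).resolve_left this
    · rw [Set.inter_singleton_eq_empty.2 hn, Set.indicator_of_notMem hn, measure_empty]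
  · intro m n hmn
    refine Set.disjoint_left.2 ?_
    rintro y ⟨-, hy⟩ ⟨-, hy'⟩
    exact hmn (hX (hy.symm.trans hy'))
  · exact fun n => hB.inter (measurableSet_singleton _)

variable {Ω : Type*} [MeasurableSpace Ω] {P : Measure Ω} {Ψ : Ω → Measure (Space d)}
  {X : ℕ → Ω → Space d}

/-- This replaces the random index set by ℕ. Everything is proved for `pointMeasure` and transferred
along this almost sure equality. -/
theorem IsEnumeration.displaced_ae_eq (hX : IsEnumeration P Ψ X) (Z : Ω → Space d → Space d) :
    displaced Ψ Z =ᵐ[P] fun ω => pointMeasure fun n => Z ω (X n ω) := by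
  filter_upwards [hX.injective, hX.range_eq] with ω h1 h2
  exact (Measure.sum_comp_equiv ((Equiv.ofInjective _ h1).trans (Equiv.setCongr h2))
    fun x : points (Ψ ω) => Measure.dirac (Z ω x)).symm

theorem IsEnumeration.ae_eq_pointMeasure [AddAction (Space d) Ω]
    {τ : Ω → Space d → Option (Space d)} (hX : IsEnumeration P Ψ X)
    (h : IsInvariantPartition P Ψ τ) : Ψ =ᵐ[P] fun ω => pointMeasure fun n => X n ω := by
  filter_upwards [hX.injective, hX.range_eq, h.simple] with ω h1 h2 h3
  have := h.locallyFinite ω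
  exact eq_pointMeasure (h.integerValued ω) h3 h1 h2

end RandomMeasures

/-! ### Stationarity -/

namespace RandomMeasures

variable {Ω : Type*} [MeasurableSpace Ω] {d : ℕ}
  {P : Measure Ω} {Ψ : Ω → Measure (Space d)} {τ : Ω → Space d → Option (Space d)}
  {X : ℕ → Ω → Space d} {ζ : Ω → ℕ → Space d}

theorem isStationary_congr {Φ Φ' : Ω → Measure (Space d)} (h : Φ =ᵐ[P] Φ')
    (hΦ : IsStationary P Φ) : IsStationary P Φ' := by
  intro x
  rw [← Measure.map_congr h, ← hΦ x]
  exact Measure.map_congr (h.mono fun ω hω => by simp only [hω])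

variable [AddAction (Space d) Ω]

namespace IsInvariantPartition

theorem mem_cell_vadd (h : IsInvariantPartition P Ψ τ) (ω : Ω) (x y z : Space d) :
    y ∈ cell τ (x +ᵥ ω) (z - x) ↔ y + x ∈ cell τ ω z := by
  have := h.equivariant ω (y + x) x
  rw [add_sub_cancel_right] at this
  simp [cell, this]

theorem mem_points_vadd (h : IsInvariantPartition P Ψ τ) (ω : Ω) (x z : Space d) :
    z - x ∈ points (Ψ (x +ᵥ ω)) ↔ z ∈ points (Ψ ω) := by
  rw [points, points, Set.mem_ofPred_eq, Set.mem_ofPred_eq, h.invariant,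
    shiftMeasure_apply _ _ (measurableSet_singleton _)]
  have : (fun y => y - x) ⁻¹' {z - x} = {z} := by ext; simp
  rw [this]

theorem cells_eq_univ (h : IsInvariantPartition P Ψ τ) (hX : IsEnumeration P Ψ X) :
    ∀ᵐ ω ∂P, ⋃ n, cell τ ω (X n ω) = Set.univ := by
  filter_upwards [hX.range_eq, h.ae_ne_zero] with ω h1 h2
  refine Set.eq_univ_of_forall fun y => ?_
  obtain ⟨z, hz, hy⟩ := h.allocation_mem ω h2 y
  obtain ⟨n, rfl⟩ := h1 ▸ hz
  exact Set.mem_iUnion.2 ⟨n, hy⟩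

/-- The cells partition space, so sums over centres become integrals over ℝ^d. The exceptional null
set does not depend on f. -/
theorem tsum_setLIntegral_cell (h : IsInvariantPartition P Ψ τ) (hX : IsEnumeration P Ψ X) :
    ∀ᵐ ω ∂P, ∀ f : Space d → ℝ≥0∞, ∑' n, ∫⁻ x in cell τ ω (X n ω), f x = ∫⁻ x, f x := by
  filter_upwards [h.cells_eq_univ hX, hX.injective] with ω h1 h2 f
  rw [← lintegral_iUnion (fun n => h.measurableSet_cell ω _), h1, Measure.restrict_univ]
  intro m n hmn
  refine Set.disjoint_left.2 fun y hy hy' => hmn (h2 ?_)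
  simpa using hy.symm.trans hy'

variable [MeasurableVAdd₂ (Space d) Ω] [VAddInvariantMeasure (Space d) Ω P]

theorem ae_vadd {p : Ω → Prop} (hp : ∀ᵐ ω ∂P, p ω) (x : Space d) : ∀ᵐ ω ∂P, p (x +ᵥ ω) :=
  (measurePreserving_vadd x P).quasiMeasurePreserving.ae hp

/-- The enumeration need not be equivariant. It and its shifted version are injective enumerations
of the same set, so they differ by a permutation. -/
theorem exists_equiv_vadd (h : IsInvariantPartition P Ψ τ) (hX : IsEnumeration P Ψ X)
    (x : Space d) : ∀ᵐ ω ∂P, ∃ σ : ℕ ≃ ℕ, ∀ n, X n (x +ᵥ ω) = X (σ n) ω - x := by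
  filter_upwards [hX.injective, hX.range_eq, ae_vadd hX.injective x, ae_vadd hX.range_eq x]
    with ω h1 h2 h3 h4
  have h5 : Function.Injective fun n => X n (x +ᵥ ω) + x := fun m n hmn => h3 (by simpa using hmn)
  have h6 : Set.range (fun n => X n (x +ᵥ ω) + x) = Set.range fun n => X n ω := by
    rw [h2]
    ext z
    rw [← h.mem_points_vadd ω x, ← h4]
    simp [eq_sub_iff_add_eq]
  refine ⟨(Equiv.ofInjective _ h5).trans ((Equiv.setCongr h6).trans (Equiv.ofInjective _ h1).symm),
    fun n => ?_⟩
  rw [eq_sub_iff_add_eq]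
  have := Equiv.apply_ofInjective_symm h1
    ((Equiv.setCongr h6) ((Equiv.ofInjective _ h5) n))
  exact this.symm

/-- Shifting ω translates the cells, hence their uniform laws, and permutes the labels. A point
measure does not see the labels. -/
theorem map_pointMeasure_vadd (h : IsInvariantPartition P Ψ τ) (hX : IsEnumeration P Ψ X)
    (hf : IsFair P Ψ τ) (h0 : intensity P Ψ ≠ 0) (x : Space d) :
    ∀ᵐ ω ∂P, (Measure.infinitePi fun n => uniformLaw (cell τ (x +ᵥ ω) (X n (x +ᵥ ω)))).map
        pointMeasure =
      (Measure.infinitePi fun n => uniformLaw (cell τ ω (X n ω))).map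
        fun z => shiftMeasure x (pointMeasure z) := by
  have hu := hf.uniformLaw_eq h0 h.intensity_ne_top
  filter_upwards [h.exists_equiv_vadd hX x, hX.range_eq, ae_vadd hX.range_eq x, hu, ae_vadd hu x]
    with ω ⟨σ, hσ⟩ h1 h2 h3 h4
  have hs : Measurable fun y : Space d => y - x := measurable_sub_const x
  have key (n : ℕ) : uniformLaw (cell τ (x +ᵥ ω) (X n (x +ᵥ ω)))
      = (uniformLaw (cell τ ω (X (σ n) ω))).map fun y => y - x := by
    rw [(h3 _ (h1 ▸ ⟨σ n, rfl⟩)).2, (h4 _ (h2 ▸ ⟨n, rfl⟩)).2, Measure.map_smul]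
    congr 1
    have : cell τ ω (X (σ n) ω) = (fun y => y - x) ⁻¹' cell τ (x +ᵥ ω) (X n (x +ᵥ ω)) := by
      ext y
      rw [hσ, Set.mem_preimage, h.mem_cell_vadd, sub_add_cancel]
    rw [this, ← Measure.restrict_map hs (h.measurableSet_cell _ _),
      (measurePreserving_sub_right volume x).map_eq]
  simp_rw [key]
  have hperm : Measurable fun (z : ℕ → Space d) n => z (σ n) := by fun_prop
  have hsub : Measurable fun (z : ℕ → Space d) n => z n - x := by fun_prop
  have e : (Measure.infinitePi fun n => (uniformLaw (cell τ ω (X (σ n) ω))).map fun y => y - x)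
      = (Measure.infinitePi fun n => uniformLaw (cell τ ω (X n ω))).map
        fun z n => z (σ n) - x := by
    rw [← Measure.infinitePi_map_pi (fun n => uniformLaw (cell τ ω (X (σ n) ω))) (fun _ => hs),
      ← Measure.map_infinitePi_infinitePi_of_inj
        (P := fun n => uniformLaw (cell τ ω (X n ω))) σ.injective,
      Measure.map_map hsub hperm]
    rfl
  have hps : Measurable fun (z : ℕ → Space d) n => z (σ n) - x := hsub.comp hperm
  rw [e, Measure.map_map measurable_pointMeasure hps]
  congr 1
  funext z
  rw [shiftMeasure_pointMeasure, ← pointMeasure_comp_equiv _ σ]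
  rfl

end IsInvariantPartition

theorem measurable_shiftMeasure (x : Space d) : Measurable (shiftMeasure x) :=
  Measure.measurable_map _ (measurable_sub_const x)

/-- `ζ` is distributed, given the partition, as a sequence of independent uniformly distributed
points in the cells with centers `X n`. -/
structure IsUniformSample (P : Measure Ω) (τ : Ω → Space d → Option (Space d))
    (X : ℕ → Ω → Space d) (ζ : Ω → ℕ → Space d) : Prop where
  aemeasurable : AEMeasurable ζ P
  map_eq : P.map ζ = P.bind fun ω => Measure.infinitePi fun n => uniformLaw (cell τ ω (X n ω))

/-- The sample ζ itself need not be equivariant. Only its law given the partition is, and invariance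
of P then suffices. -/
theorem IsUniformSample.isStationary [MeasurableVAdd₂ (Space d) Ω]
    [VAddInvariantMeasure (Space d) Ω P]
    (hζ : IsUniformSample P τ X ζ) (h : IsInvariantPartition P Ψ τ) (hX : IsEnumeration P Ψ X)
    (hf : IsFair P Ψ τ) (h0 : intensity P Ψ ≠ 0) :
    IsStationary P fun ω => pointMeasure (ζ ω) := by
  intro x
  have hK : Measurable fun ω => Measure.infinitePi fun n => uniformLaw (cell τ ω (X n ω)) :=
    measurable_infinitePi fun n => h.measurable_uniformLaw (hX.measurable n)
  have hpm := measurable_pointMeasure (E := Space d)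
  have hsp : Measurable fun z : ℕ → Space d => shiftMeasure x (pointMeasure z) :=
    (measurable_shiftMeasure x).comp hpm
  have e1 : P.map (fun ω => shiftMeasure x (pointMeasure (ζ ω)))
      = (P.map ζ).map fun z => shiftMeasure x (pointMeasure z) :=
    (AEMeasurable.map_map_of_aemeasurable hsp.aemeasurable hζ.aemeasurable).symm
  have e2 : P.map (fun ω => pointMeasure (ζ ω)) = (P.map ζ).map pointMeasure :=
    (AEMeasurable.map_map_of_aemeasurable hpm.aemeasurable hζ.aemeasurable).symm
  rw [e1, e2, hζ.map_eq]
  ext A hA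
  rw [Measure.map_apply hsp hA, Measure.map_apply hpm hA, Measure.bind_apply (hsp hA)
    hK.aemeasurable, Measure.bind_apply (hpm hA) hK.aemeasurable]
  symm
  rw [← IsInvariantPartition.lintegral_vadd x]
  refine lintegral_congr_ae ?_
  filter_upwards [h.map_pointMeasure_vadd hX hf h0 x] with ω hω
  rw [← Measure.map_apply hpm hA, ← Measure.map_apply hsp hA, hω]

end RandomMeasures

/-! ### First and second moments -/

namespace RandomMeasures

variable {Ω : Type*} [MeasurableSpace Ω] {d : ℕ}

/-- The probability that `y` belongs to the zero cell. -/
noncomputable def coverProb (P : Measure Ω) (τ : Ω → Space d → Option (Space d)) (y : Space d) :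
    ℝ≥0∞ := P {ω | y ∈ zeroCell τ ω}

variable [AddAction (Space d) Ω]
  {P : Measure Ω} {Ψ : Ω → Measure (Space d)} {τ : Ω → Space d → Option (Space d)}
  {X : ℕ → Ω → Space d} {ζ : Ω → ℕ → Space d}

namespace IsInvariantPartition

theorem measurable_coverProb [SFinite P] (h : IsInvariantPartition P Ψ τ) :
    Measurable (coverProb P τ) :=
  measurable_measure_prodMk_left (s := {p : Space d × Ω | τ p.2 p.1 = τ p.2 0})
    (h.measurableSet_eq measurable_snd measurable_fst measurable_const)

theorem allocation_vadd_eq_iff (h : IsInvariantPartition P Ψ τ) (ω : Ω) (x y z : Space d) :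
    τ (z +ᵥ ω) (x - z) = τ (z +ᵥ ω) (y - z) ↔ τ ω x = τ ω y := by
  rw [h.equivariant, h.equivariant]
  exact (Option.map_injective (sub_left_injective (b := z))).eq_iff

theorem measure_allocation_eq [MeasurableVAdd₂ (Space d) Ω]
    [VAddInvariantMeasure (Space d) Ω P] (h : IsInvariantPartition P Ψ τ) (x y : Space d) :
    P {ω | τ ω x = τ ω y} = coverProb P τ (y - x) := by
  have hm (u v : Space d) : MeasurableSet {ω | τ ω u = τ ω v} :=
    h.measurableSet_eq measurable_id measurable_const measurable_const
  rw [coverProb, ← measure_preimage_vadd P x {ω | y - x ∈ zeroCell τ ω}]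
  congr 1
  ext ω
  have := h.allocation_vadd_eq_iff ω x y x
  rw [sub_self] at this
  rw [Set.mem_ofPred_eq, ← this, eq_comm]
  rfl

theorem volume_zeroCell (h : IsInvariantPartition P Ψ τ) (hf : IsFair P Ψ τ) :
    ∀ᵐ ω ∂P, ∀ y, volume {x | τ ω x = τ ω y} = (intensity P Ψ)⁻¹ := by
  filter_upwards [hf, h.ae_ne_zero] with ω h1 h2 y
  obtain ⟨z, hz, hy⟩ := h.allocation_mem ω h2 y
  rw [hy]
  exact h1 z hz

/-- By Fubini this is the mean volume of the zero cell. The value is exactly what makes γδ₀ - γ²κλ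
have total mass zero. -/
theorem lintegral_coverProb [IsProbabilityMeasure P] (h : IsInvariantPartition P Ψ τ)
    (hf : IsFair P Ψ τ) : ∫⁻ y, coverProb P τ y = (intensity P Ψ)⁻¹ := by
  have hS : MeasurableSet {p : Space d × Ω | τ p.2 p.1 = τ p.2 0} :=
    h.measurableSet_eq measurable_snd measurable_fst measurable_const
  have h1 := Measure.prod_apply (μ := (volume : Measure (Space d))) (ν := P) hS
  rw [Measure.prod_apply_symm hS] at h1
  rw [show ∫⁻ y, coverProb P τ y = _ from h1.symm]
  calc _ = ∫⁻ ω, (intensity P Ψ)⁻¹ ∂P := lintegral_congr_ae <| by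
        filter_upwards [h.volume_zeroCell hf] with ω hω using hω 0
    _ = _ := by simp

end IsInvariantPartition

namespace IsUniformSample

theorem lintegral_eq (hζ : IsUniformSample P τ X ζ) (h : IsInvariantPartition P Ψ τ)
    (hX : IsEnumeration P Ψ X) {G : (ℕ → Space d) → ℝ≥0∞} (hG : Measurable G) :
    ∫⁻ ω, G (ζ ω) ∂P
      = ∫⁻ ω, ∫⁻ z, G z ∂(Measure.infinitePi fun n => uniformLaw (cell τ ω (X n ω))) ∂P := by
  have hK : Measurable fun ω => Measure.infinitePi fun n => uniformLaw (cell τ ω (X n ω)) :=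
    measurable_infinitePi fun n => h.measurable_uniformLaw (hX.measurable n)
  rw [← lintegral_map' hG.aemeasurable hζ.aemeasurable, hζ.map_eq,
    Measure.lintegral_bind hK.aemeasurable hG.aemeasurable]

/-- Campbell's formula for the displaced point process. -/
theorem lintegral_tsum [IsProbabilityMeasure P] (hζ : IsUniformSample P τ X ζ)
    (h : IsInvariantPartition P Ψ τ)
    (hX : IsEnumeration P Ψ X) (hf : IsFair P Ψ τ) (h0 : intensity P Ψ ≠ 0)
    {F : Space d → ℝ≥0∞} (hF : Measurable F) :
    ∫⁻ ω, ∑' n, F (ζ ω n) ∂P = intensity P Ψ * ∫⁻ x, F x := by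
  rw [hζ.lintegral_eq h hX (G := fun z => ∑' n, F (z n)) (by fun_prop)]
  calc _ = ∫⁻ _, intensity P Ψ * (∫⁻ x, F x) ∂P := lintegral_congr_ae ?_
    _ = _ := by simp
  filter_upwards [hX.range_eq, hf.uniformLaw_eq h0 h.intensity_ne_top, h.tsum_setLIntegral_cell hX]
    with ω h1 h2 h3
  have hFn (n : ℕ) : Measurable fun z : ℕ → Space d => F (z n) := hF.comp (measurable_pi_apply n)
  rw [MeasureTheory.lintegral_tsum fun n => (hFn n).aemeasurable, ← h3, ← ENNReal.tsum_mul_left]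
  refine tsum_congr fun n => ?_
  rw [← (lintegral_map hF (measurable_pi_apply n) :
    ∫⁻ x, F x ∂(Measure.map (fun z : ℕ → Space d => z n) _) = _), Measure.infinitePi_map_eval,
    (h2 _ (h1 ▸ ⟨n, rfl⟩)).2, lintegral_smul_measure, smul_eq_mul]

/-- The second moment formula given the partition. -/
theorem lintegral_infinitePi_tsum_tsum (h : IsInvariantPartition P Ψ τ)
    (hX : IsEnumeration P Ψ X) (hf : IsFair P Ψ τ) (h0 : intensity P Ψ ≠ 0)
    {F : Space d → Space d → ℝ≥0∞} (hF : Measurable (Function.uncurry F)) :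
    ∀ᵐ ω ∂P, (∫⁻ z, ∑' n, ∑' m, F (z n) (z m)
        ∂(Measure.infinitePi fun n => uniformLaw (cell τ ω (X n ω))))
        + intensity P Ψ ^ 2 * ∫⁻ x, ∫⁻ y, {y | τ ω x = τ ω y}.indicator (F x) y
      = intensity P Ψ * (∫⁻ x, F x x) + intensity P Ψ ^ 2 * ∫⁻ x, ∫⁻ y, F x y := by
  filter_upwards [hX.range_eq, hf.uniformLaw_eq h0 h.intensity_ne_top, h.tsum_setLIntegral_cell hX]
    with ω h1 h2 h3
  set γ := intensity P Ψ
  have hFF (n m : ℕ) : Measurable fun z : ℕ → Space d => F (z n) (z m) :=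
    hF.comp (by fun_prop : Measurable fun z : ℕ → Space d => (z n, z m))
  have hdiag : Measurable fun x => F x x :=
    hF.comp (by fun_prop : Measurable fun x : Space d => (x, x))
  have hu (n : ℕ) : uniformLaw (cell τ ω (X n ω)) = γ • volume.restrict (cell τ ω (X n ω)) :=
    (h2 _ (h1 ▸ ⟨n, rfl⟩)).2
  set a : ℕ → ℕ → ℝ≥0∞ := fun n m => ∫⁻ z, F (z n) (z m)
    ∂(Measure.infinitePi fun n => uniformLaw (cell τ ω (X n ω))) with ha
  set b : ℕ → ℕ → ℝ≥0∞ := fun n m =>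
    γ ^ 2 * ∫⁻ x in cell τ ω (X n ω), ∫⁻ y in cell τ ω (X m ω), F x y with hb
  set c : ℕ → ℝ≥0∞ := fun n => γ * ∫⁻ x in cell τ ω (X n ω), F x x with hc
  -- Independence enters only here: two distinct coordinates have the product law, with density γ²
  -- on the product of their cells.
  have hab {n m : ℕ} (hnm : n ≠ m) : a n m = b n m := by
    have := lintegral_map hF (by fun_prop : Measurable fun z : ℕ → Space d => (z n, z m))
      (μ := Measure.infinitePi fun n => uniformLaw (cell τ ω (X n ω)))
    rw [Measure.infinitePi_map_eval_prod hnm, lintegral_prod _ hF.aemeasurable] at this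
    rw [ha, hb]
    refine this.symm.trans ?_
    simp only [hu, lintegral_smul_measure, Function.uncurry, smul_eq_mul]
    rw [lintegral_const_mul _ (Measurable.lintegral_prod_right'
      (f := fun q : Space d × Space d => F q.1 q.2) hF), ← mul_assoc, sq]
  have hac (n : ℕ) : a n n = c n := by
    rw [ha, hc]
    beta_reduce
    rw [← (lintegral_map hdiag (measurable_pi_apply n) :
      ∫⁻ x, F x x ∂(Measure.map (fun z : ℕ → Space d => z n) _) = _), Measure.infinitePi_map_eval,
      hu, lintegral_smul_measure, smul_eq_mul]
  have e1 : ∫⁻ z, ∑' n, ∑' m, F (z n) (z m)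
      ∂(Measure.infinitePi fun n => uniformLaw (cell τ ω (X n ω))) = ∑' n, ∑' m, a n m := by
    rw [MeasureTheory.lintegral_tsum fun n => (Measurable.tsum fun m => hFF n m).aemeasurable]
    exact tsum_congr fun n => MeasureTheory.lintegral_tsum fun m => (hFF n m).aemeasurable
  -- Pairs sharing a cell fill the diagonal blocks, the terms present in γ²∬F but absent from the
  -- distinct pairs.
  have e2 : γ ^ 2 * ∫⁻ x, ∫⁻ y, {y | τ ω x = τ ω y}.indicator (F x) y = ∑' n, b n n := by
    rw [← h3, ← ENNReal.tsum_mul_left]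
    refine tsum_congr fun n => ?_
    rw [hb]
    congr 1
    refine setLIntegral_congr_fun (h.measurableSet_cell _ _) fun x hx => ?_
    have : {y | τ ω x = τ ω y} = cell τ ω (X n ω) := by
      ext y
      rw [cell, Set.mem_ofPred_eq, Set.mem_ofPred_eq, show τ ω x = some (X n ω) from hx, eq_comm]
    simp only [this]
    rw [lintegral_indicator (h.measurableSet_cell _ _)]
  have e3 : γ * ∫⁻ x, F x x = ∑' n, c n := by
    rw [← h3, ← ENNReal.tsum_mul_left]
  have e4 : γ ^ 2 * ∫⁻ x, ∫⁻ y, F x y = ∑' n, ∑' m, b n m := by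
    rw [← h3, ← ENNReal.tsum_mul_left]
    refine tsum_congr fun n => ?_
    simp only [hb]
    rw [ENNReal.tsum_mul_left, ← MeasureTheory.lintegral_tsum]
    · simp_rw [h3]
    · exact fun m => (hF.lintegral_prod_right' (ν := volume.restrict _)).aemeasurable
  rw [e1, e2, e3, e4, ← ENNReal.tsum_add, ← ENNReal.tsum_add]
  refine tsum_congr fun n => ?_
  -- The rows of a and b share the same off-diagonal remainder r. The identity then needs no
  -- subtraction, even if r is infinite.
  obtain ⟨r, hr, hr'⟩ : ∃ r, ∑' m, a n m = a n n + r ∧ ∑' m, b n m = b n n + r := by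
    refine ⟨_, ENNReal.tsum_eq_add_tsum_ite n, (ENNReal.tsum_eq_add_tsum_ite n).trans ?_⟩
    congr 1
    refine tsum_congr fun m => ?_
    split_ifs with hmn
    exacts [rfl, (hab (Ne.symm hmn)).symm]
  rw [hr, hr', hac]
  ring

/-- The second moment formula for the displaced point process. -/
theorem lintegral_tsum_tsum [IsProbabilityMeasure P] [MeasurableVAdd₂ (Space d) Ω]
    [VAddInvariantMeasure (Space d) Ω P] (hζ : IsUniformSample P τ X ζ)
    (h : IsInvariantPartition P Ψ τ)
    (hX : IsEnumeration P Ψ X) (hf : IsFair P Ψ τ) (h0 : intensity P Ψ ≠ 0)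
    {F : Space d → Space d → ℝ≥0∞} (hF : Measurable (Function.uncurry F)) :
    (∫⁻ ω, ∑' n, ∑' m, F (ζ ω n) (ζ ω m) ∂P)
        + intensity P Ψ ^ 2 * ∫⁻ x, ∫⁻ y, coverProb P τ (y - x) * F x y
      = intensity P Ψ * (∫⁻ x, F x x) + intensity P Ψ ^ 2 * ∫⁻ x, ∫⁻ y, F x y := by
  have hFF (n m : ℕ) : Measurable fun z : ℕ → Space d => F (z n) (z m) :=
    hF.comp (by fun_prop : Measurable fun z : ℕ → Space d => (z n, z m))
  have hI : Measurable fun q : (Ω × Space d) × Space d =>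
      {y | τ q.1.1 q.1.2 = τ q.1.1 y}.indicator (F q.1.2) q.2 := by
    have : Measurable fun q : (Ω × Space d) × Space d => F q.1.2 q.2 :=
      hF.comp (by fun_prop : Measurable fun q : (Ω × Space d) × Space d => (q.1.2, q.2))
    exact this.indicator (s := {q : (Ω × Space d) × Space d | τ q.1.1 q.1.2 = τ q.1.1 q.2})
      (h.measurableSet_eq (by fun_prop) (by fun_prop) (by fun_prop))
  have hI' : Measurable fun q : Ω × Space d =>
      ∫⁻ y, {y | τ q.1 q.2 = τ q.1 y}.indicator (F q.2) y := hI.lintegral_prod_right'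
  have hI'' : Measurable fun ω =>
      ∫⁻ x, ∫⁻ y, {y | τ ω x = τ ω y}.indicator (F x) y := hI'.lintegral_prod_right'
  have e1 : ∫⁻ x, ∫⁻ y, coverProb P τ (y - x) * F x y
      = ∫⁻ ω, (∫⁻ x, ∫⁻ y, {y | τ ω x = τ ω y}.indicator (F x) y) ∂P := by
    rw [lintegral_lintegral_swap (f := fun ω x => ∫⁻ y, {y | τ ω x = τ ω y}.indicator (F x) y)
      hI'.aemeasurable]
    refine lintegral_congr fun x => ?_
    rw [lintegral_lintegral_swap]
    · refine lintegral_congr fun y => ?_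
      have hS : MeasurableSet {ω | τ ω x = τ ω y} :=
        h.measurableSet_eq measurable_id measurable_const measurable_const
      rw [← h.measure_allocation_eq x y, mul_comm, ← lintegral_indicator_const hS]
      rfl
    · exact (hI.comp (by fun_prop :
        Measurable fun q : Ω × Space d => ((q.1, x), q.2))).aemeasurable
  rw [e1, hζ.lintegral_eq h hX (G := fun z => ∑' n, ∑' m, F (z n) (z m))
    (.tsum fun n => .tsum fun m => hFF n m), ← lintegral_const_mul _ hI'',
    ← lintegral_add_right _ (hI''.const_mul _),
    lintegral_congr_ae (lintegral_infinitePi_tsum_tsum h hX hf h0 hF)]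
  simp

end IsUniformSample

end RandomMeasures

/-! ### The reduced second moment measure -/

namespace RandomMeasures

section Differences

variable {d : ℕ}

theorem map_sub_prod_pointMeasure_apply (z : ℕ → Space d) {S : Set (Space d)}
    (hS : MeasurableSet S) :
    ((((pointMeasure z).restrict (unitCube d)).prod (pointMeasure z)).map
      (fun p => p.2 - p.1)) S
      = ∑' n, ∑' m, (unitCube d).indicator 1 (z n) * S.indicator 1 (z m - z n) := by
  have hsub : Measurable fun p : Space d × Space d => p.2 - p.1 := by fun_prop
  rw [Measure.map_apply hsub hS, Measure.prod_apply (hsub hS),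
    ← lintegral_indicator measurableSet_unitCube,
    lintegral_pointMeasure _
      ((measurable_measure_prodMk_left (hsub hS)).indicator measurableSet_unitCube)]
  refine tsum_congr fun n => ?_
  rw [ENNReal.tsum_mul_left]
  by_cases hn : z n ∈ unitCube d
  · rw [Set.indicator_of_mem hn, Set.indicator_of_mem hn, Pi.one_apply, one_mul,
      pointMeasure_apply _ (measurable_prodMk_left (hsub hS))]
    rfl
  · simp [hn]

theorem measurable_map_sub_prod_pointMeasure : Measurable fun z : ℕ → Space d =>
    (((pointMeasure z).restrict (unitCube d)).prod (pointMeasure z)).map (fun p => p.2 - p.1) := by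
  refine Measure.measurable_of_measurable_coe _ fun S hS => ?_
  simp_rw [map_sub_prod_pointMeasure_apply _ hS]
  refine .tsum fun n => .tsum fun m => Measurable.mul ?_ ?_
  · exact (measurable_one.indicator measurableSet_unitCube).comp (measurable_pi_apply n)
  · exact (measurable_one.indicator hS).comp
      (by fun_prop : Measurable fun z : ℕ → Space d => z m - z n)

end Differences

section Congr

variable {Ω : Type*} [MeasurableSpace Ω] {d : ℕ} {P : Measure Ω} {Φ Φ' : Ω → Measure (Space d)}

theorem IsRandomMeasure.congr (hΦ : IsRandomMeasure P Φ) (h : Φ =ᵐ[P] Φ') :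
    IsRandomMeasure P Φ' :=
  ⟨hΦ.aemeasurable.congr h, by
    filter_upwards [hΦ.locallyFinite, h] with ω h1 h2 using h2 ▸ h1⟩

theorem IsPointProcess.congr (hΦ : IsPointProcess P Φ) (h : Φ =ᵐ[P] Φ') :
    IsPointProcess P Φ' :=
  ⟨hΦ.toIsRandomMeasure.congr h, by
    filter_upwards [hΦ.integerValued, h] with ω h1 h2 using h2 ▸ h1⟩

theorem IsLocallySquareIntegrable.congr (hΦ : IsLocallySquareIntegrable P Φ) (h : Φ =ᵐ[P] Φ') :
    IsLocallySquareIntegrable P Φ' := by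
  intro B hB hB'
  rw [← lintegral_congr_ae (h.mono fun ω hω => by simp only [hω] :
    (fun ω => (Φ ω B) ^ 2) =ᵐ[P] fun ω => (Φ' ω B) ^ 2)]
  exact hΦ B hB hB'

theorem IsHyperuniformWrt.congr {W : Set (Space d)} (hΦ : IsHyperuniformWrt P Φ W)
    (h : Φ =ᵐ[P] Φ') : IsHyperuniformWrt P Φ' W := by
  refine ⟨hΦ.randomMeasure.congr h, isStationary_congr h hΦ.stationary,
    hΦ.squareIntegrable.congr h, ?_⟩
  have (r : ℝ) : variance (fun ω => (Φ' ω).real (r • W)) P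
      = variance (fun ω => (Φ ω).real (r • W)) P :=
    variance_congr (h.mono fun ω hω => by simp only [hω])
  simp_rw [this]
  exact hΦ.tendsto_variance

theorem intensity_congr (h : Φ =ᵐ[P] Φ') : intensity P Φ = intensity P Φ' :=
  lintegral_congr_ae (h.mono fun ω hω => by simp only [hω])

theorem reducedSecondMoment_congr (h : Φ =ᵐ[P] Φ') :
    reducedSecondMoment P Φ = reducedSecondMoment P Φ' :=
  Measure.bind_congr_right (h.mono fun ω hω => by simp only [hω])

theorem IsStructureFactor.congr {S : Space d → ℝ} (hΦ : IsStructureFactor P Φ S)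
    (h : Φ =ᵐ[P] Φ') : IsStructureFactor P Φ' S := by
  have hi := intensity_congr h
  have hr := reducedSecondMoment_congr h
  refine ⟨hΦ.randomMeasure.congr h, isStationary_congr h hΦ.stationary,
    hΦ.squareIntegrable.congr h, ?_, hΦ.continuous, hΦ.nonneg, ?_⟩
  · have := hΦ.finiteVariation
    rwa [CovarianceMeasureFiniteVariation, hi, hr] at this
  · obtain ⟨h1, h2, h3⟩ := hΦ.density
    rw [hi] at h1 h2 h3
    rw [hr] at h3
    exact ⟨h1, h2, h3⟩

/-- The witness is γδ₀ - γ²κλ, a difference of finite measures. The volume term cancels on bounded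
sets, where everything is finite. -/
theorem covarianceMeasureFiniteVariation_of_add_eq {Φ : Ω → Measure (Space d)} {γ : ℝ≥0∞}
    {κ : Space d → ℝ≥0∞} (hγ : γ ≠ ∞) (hκ : ∫⁻ y, κ y ≠ ∞) (hi : intensity P Φ = γ)
    (h : reducedSecondMoment P Φ + γ ^ 2 • volume.withDensity κ
      = γ • Measure.dirac 0 + γ ^ 2 • volume) :
    CovarianceMeasureFiniteVariation P Φ := by
  have h1 : IsFiniteMeasure (volume.withDensity κ) := isFiniteMeasure_withDensity hκ
  have h2 : IsFiniteMeasure (γ ^ 2 • volume.withDensity κ) :=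
    Measure.smul_finite _ (ENNReal.pow_ne_top hγ)
  have h3 : IsFiniteMeasure (γ • Measure.dirac (0 : Space d)) := Measure.smul_finite _ hγ
  refine ⟨(γ • Measure.dirac (0 : Space d)).toSignedMeasure
    - (γ ^ 2 • volume.withDensity κ).toSignedMeasure, fun B hB hB' => ?_⟩
  have hv : volume B ≠ ∞ := hB'.measure_lt_top.ne
  have key := congrArg (fun μ : Measure (Space d) => μ B) h
  simp only [Measure.add_apply] at key
  have hfin : reducedSecondMoment P Φ B ≠ ∞ := by
    refine ne_top_of_le_ne_top ?_ (le_self_add.trans_eq key)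
    rw [Measure.smul_apply (γ ^ 2), smul_eq_mul]
    finiteness
  have key' := congrArg ENNReal.toReal key
  rw [ENNReal.toReal_add hfin (measure_ne_top _ _), ENNReal.toReal_add (measure_ne_top _ _)
    (by rw [Measure.smul_apply, smul_eq_mul]; finiteness)] at key'
  rw [_root_.sub_apply, Measure.toSignedMeasure_apply_measurable hB,
    Measure.toSignedMeasure_apply_measurable hB, hi]
  rw [Measure.smul_apply (γ ^ 2) volume, smul_eq_mul, ENNReal.toReal_mul, ENNReal.toReal_pow]
    at key'
  simp only [measureReal_def]
  linarith

end Congr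

variable {Ω : Type*} [MeasurableSpace Ω] {d : ℕ} [AddAction (Space d) Ω]
  {P : Measure Ω} {Ψ : Ω → Measure (Space d)} {τ : Ω → Space d → Option (Space d)}
  {X : ℕ → Ω → Space d} {ζ : Ω → ℕ → Space d}

namespace IsUniformSample

theorem lintegral_pointMeasure [IsProbabilityMeasure P] (hζ : IsUniformSample P τ X ζ)
    (h : IsInvariantPartition P Ψ τ) (hX : IsEnumeration P Ψ X) (hf : IsFair P Ψ τ)
    (h0 : intensity P Ψ ≠ 0) {B : Set (Space d)} (hB : MeasurableSet B) :
    ∫⁻ ω, pointMeasure (ζ ω) B ∂P = intensity P Ψ * volume B := by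
  simp_rw [pointMeasure_apply _ hB]
  rw [hζ.lintegral_tsum h hX hf h0 (measurable_one.indicator hB), lintegral_indicator_one hB]

theorem intensity_pointMeasure [IsProbabilityMeasure P] (hζ : IsUniformSample P τ X ζ)
    (h : IsInvariantPartition P Ψ τ) (hX : IsEnumeration P Ψ X) (hf : IsFair P Ψ τ)
    (h0 : intensity P Ψ ≠ 0) :
    intensity P (fun ω => pointMeasure (ζ ω)) = intensity P Ψ := by
  rw [intensity, hζ.lintegral_pointMeasure h hX hf h0 measurableSet_unitCube, volume_unitCube,
    mul_one]

theorem isPointProcess [IsProbabilityMeasure P] (hζ : IsUniformSample P τ X ζ)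
    (h : IsInvariantPartition P Ψ τ) (hX : IsEnumeration P Ψ X) (hf : IsFair P Ψ τ)
    (h0 : intensity P Ψ ≠ 0) : IsPointProcess P fun ω => pointMeasure (ζ ω) := by
  have hm : AEMeasurable (fun ω => pointMeasure (ζ ω)) P :=
    measurable_pointMeasure.comp_aemeasurable hζ.aemeasurable
  refine ⟨⟨hm, ?_⟩, ae_of_all _ fun ω => isIntegerValued_pointMeasure _⟩
  -- Local finiteness comes from finite means on a countable exhaustion by balls.
  have h1 : ∀ᵐ ω ∂P, ∀ n : ℕ, pointMeasure (ζ ω) (Metric.ball 0 n) < ∞ := by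
    refine ae_all_iff.2 fun n => ae_lt_top' ?_ ?_
    · exact (Measure.measurable_coe measurableSet_ball).comp_aemeasurable hm
    · rw [hζ.lintegral_pointMeasure h hX hf h0 measurableSet_ball]
      exact ENNReal.mul_ne_top h.intensity_ne_top measure_ball_lt_top.ne
  filter_upwards [h1] with ω hω
  refine ⟨fun x => ?_⟩
  obtain ⟨n, hn⟩ := exists_nat_gt ‖x‖
  exact ⟨Metric.ball 0 n, Metric.isOpen_ball.mem_nhds (by simpa using hn), hω n⟩

variable [MeasurableVAdd₂ (Space d) Ω] [VAddInvariantMeasure (Space d) Ω P]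

theorem lintegral_pointMeasure_sq [IsProbabilityMeasure P] (hζ : IsUniformSample P τ X ζ)
    (h : IsInvariantPartition P Ψ τ) (hX : IsEnumeration P Ψ X) (hf : IsFair P Ψ τ)
    (h0 : intensity P Ψ ≠ 0) {B : Set (Space d)} (hB : MeasurableSet B) :
    (∫⁻ ω, pointMeasure (ζ ω) B ^ 2 ∂P)
      + intensity P Ψ ^ 2 * ∫⁻ x in B, ∫⁻ y in B, coverProb P τ (y - x)
      = intensity P Ψ * volume B + intensity P Ψ ^ 2 * volume B ^ 2 := by
  have hI : Measurable (B.indicator (1 : Space d → ℝ≥0∞)) := measurable_one.indicator hB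
  have key := hζ.lintegral_tsum_tsum h hX hf h0
    (F := fun x y => B.indicator 1 x * B.indicator 1 y)
    ((hI.comp measurable_fst).mul (hI.comp measurable_snd))
  have e1 (ω : Ω) : pointMeasure (ζ ω) B ^ 2
      = ∑' n, ∑' m, B.indicator 1 (ζ ω n) * B.indicator 1 (ζ ω m) := by
    rw [pointMeasure_apply _ hB, sq, ← ENNReal.tsum_mul_right]
    simp_rw [ENNReal.tsum_mul_left]
  have e2 : ∫⁻ x in B, ∫⁻ y in B, coverProb P τ (y - x)
      = ∫⁻ x, ∫⁻ y, coverProb P τ (y - x) * (B.indicator 1 x * B.indicator 1 y) := by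
    rw [← lintegral_indicator hB]
    refine lintegral_congr fun x => ?_
    by_cases hx : x ∈ B
    · rw [Set.indicator_of_mem hx, ← lintegral_indicator hB]
      refine lintegral_congr fun y => ?_
      by_cases hy : y ∈ B <;> simp [hx, hy]
    · simp [hx]
  have e3 : ∫⁻ x, B.indicator 1 x * B.indicator (1 : Space d → ℝ≥0∞) x = volume B := by
    rw [← lintegral_indicator_one hB]
    refine lintegral_congr fun x => ?_
    by_cases hx : x ∈ B <;> simp [hx]
  have e4 : ∫⁻ x, ∫⁻ y, B.indicator 1 x * B.indicator (1 : Space d → ℝ≥0∞) y = volume B ^ 2 := by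
    simp_rw [lintegral_const_mul _ hI, lintegral_mul_const _ hI, lintegral_indicator_one hB, sq]
  rw [e3, e4, ← e2] at key
  simp_rw [e1]
  exact key

theorem isLocallySquareIntegrable [IsProbabilityMeasure P] (hζ : IsUniformSample P τ X ζ)
    (h : IsInvariantPartition P Ψ τ) (hX : IsEnumeration P Ψ X) (hf : IsFair P Ψ τ)
    (h0 : intensity P Ψ ≠ 0) : IsLocallySquareIntegrable P fun ω => pointMeasure (ζ ω) := by
  intro B hB hB'
  have hv : volume B ≠ ∞ := hB'.measure_lt_top.ne
  have := h.intensity_ne_top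
  refine lt_of_le_of_lt (le_self_add.trans_eq (hζ.lintegral_pointMeasure_sq h hX hf h0 hB)) ?_
  finiteness

/-- The reduced second moment measure of the displaced point process. -/
theorem reducedSecondMoment_add [IsProbabilityMeasure P] (hζ : IsUniformSample P τ X ζ)
    (h : IsInvariantPartition P Ψ τ) (hX : IsEnumeration P Ψ X) (hf : IsFair P Ψ τ)
    (h0 : intensity P Ψ ≠ 0) :
    reducedSecondMoment P (fun ω => pointMeasure (ζ ω))
        + intensity P Ψ ^ 2 • volume.withDensity (coverProb P τ)
      = intensity P Ψ • Measure.dirac 0 + intensity P Ψ ^ 2 • volume := by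
  ext S hS
  have hI : Measurable (S.indicator (1 : Space d → ℝ≥0∞)) := measurable_one.indicator hS
  have hC : Measurable ((unitCube d).indicator (1 : Space d → ℝ≥0∞)) :=
    measurable_one.indicator measurableSet_unitCube
  -- With this F the substitution y ↦ y + x separates the variables, and the cube contributes its
  -- volume 1 to each term.
  have key := hζ.lintegral_tsum_tsum h hX hf h0
    (F := fun x y => (unitCube d).indicator 1 x * S.indicator 1 (y - x))
    ((hC.comp measurable_fst).mul (hI.comp (measurable_snd.sub measurable_fst)))
  have e1 : reducedSecondMoment P (fun ω => pointMeasure (ζ ω)) S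
      = ∫⁻ ω, ∑' n, ∑' m, (unitCube d).indicator 1 (ζ ω n) * S.indicator 1 (ζ ω m - ζ ω n) ∂P := by
    have hm : AEMeasurable (fun ω => (((pointMeasure (ζ ω)).restrict (unitCube d)).prod
        (pointMeasure (ζ ω))).map fun p => p.2 - p.1) P :=
      measurable_map_sub_prod_pointMeasure.comp_aemeasurable hζ.aemeasurable
    rw [reducedSecondMoment, Measure.bind_apply hS hm]
    simp_rw [map_sub_prod_pointMeasure_apply _ hS]
  have hcube : ∫⁻ x, (unitCube d).indicator 1 x = 1 := by
    rw [lintegral_indicator_one measurableSet_unitCube, volume_unitCube]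
  have e2 : ∫⁻ x, ∫⁻ y, coverProb P τ (y - x) *
      ((unitCube d).indicator 1 x * S.indicator 1 (y - x))
      = volume.withDensity (coverProb P τ) S := by
    have (x : Space d) : ∫⁻ y, coverProb P τ (y - x) *
      ((unitCube d).indicator 1 x * S.indicator 1 (y - x)) =
        (unitCube d).indicator 1 x * ∫⁻ y, coverProb P τ y * S.indicator 1 y := by
      rw [lintegral_sub_right_eq_self (fun y => coverProb P τ y *
        ((unitCube d).indicator 1 x * S.indicator 1 y)) x, ← lintegral_const_mul]
      · exact lintegral_congr fun y => by ring
      · exact h.measurable_coverProb.mul hI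
    simp_rw [this]
    rw [lintegral_mul_const _ hC, hcube, one_mul, withDensity_apply _ hS,
      ← lintegral_indicator hS]
    refine lintegral_congr fun y => ?_
    by_cases hy : y ∈ S <;> simp [hy]
  have e3 : ∫⁻ x, (unitCube d).indicator 1 x * S.indicator (1 : Space d → ℝ≥0∞) (x - x)
      = Measure.dirac 0 S := by
    simp_rw [sub_self]
    rw [lintegral_mul_const _ hC, hcube, one_mul, Measure.dirac_apply' _ hS]
  have e4 : ∫⁻ x, ∫⁻ y, (unitCube d).indicator 1 x * S.indicator (1 : Space d → ℝ≥0∞) (y - x)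
      = volume S := by
    have (x : Space d) : ∫⁻ y, (unitCube d).indicator 1 x *
        S.indicator (1 : Space d → ℝ≥0∞) (y - x) = (unitCube d).indicator 1 x * volume S := by
      rw [lintegral_sub_right_eq_self (fun y => (unitCube d).indicator 1 x *
        S.indicator (1 : Space d → ℝ≥0∞) y) x, lintegral_const_mul _ hI, lintegral_indicator_one hS]
    simp_rw [this]
    rw [lintegral_mul_const _ hC, hcube, one_mul]
  rw [e2, e3, e4, ← e1] at key
  simpa using key

end IsUniformSample

end RandomMeasures

/-! ### The Bartlett spectral measure -/

namespace RandomMeasures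

variable {d : ℕ}

theorem IsTestFunction.integrable {f : Space d → ℝ} (hf : IsTestFunction f) : Integrable f := by
  obtain ⟨c, hc⟩ := hf.bounded
  rw [← integrableOn_iff_integrable_of_support_subset (s := Function.support f) subset_rfl]
  exact Measure.integrableOn_of_bounded hf.bounded_support.measure_lt_top.ne
    hf.measurable.aestronglyMeasurable (ae_of_all _ hc)

theorem continuous_fourierTr {f : Space d → ℝ} (hf : Integrable f) : Continuous (fourierTr f) := by
  have h1 : Continuous (FourierTransform.fourier fun x => (f x : ℂ)) :=
    VectorFourier.fourierIntegral_continuous Real.continuous_fourierChar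
      (by exact continuous_inner) hf.ofReal
  rw [show fourierTr f = fun k => _ from funext (fourierTr_eq f)]
  exact h1.comp (continuous_const_smul _)

theorem norm_fourierTr_le (f : Space d → ℝ) (k : Space d) : ‖fourierTr f k‖ ≤ ∫ x, |f x| := by
  refine (norm_integral_le_integral_norm _).trans_eq ?_
  refine integral_congr_ae (ae_of_all _ fun x => ?_)
  have : -(Complex.I * ((inner ℝ k x : ℝ) : ℂ)) = ((-(inner ℝ k x : ℝ) : ℝ) : ℂ) * Complex.I := by
    push_cast; ring
  beta_reduce
  rw [norm_mul, this, Complex.norm_exp_ofReal_mul_I, mul_one, Complex.norm_real, Real.norm_eq_abs]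

section Convolution

variable {f g κ : Space d → ℝ}

theorem tiltedConv_zero (f g : Space d → ℝ) : tiltedConv f g 0 = ∫ x, f x * g x := by
  simp [tiltedConv]

theorem integrable_mul_sub (hf : Integrable f) (hg : Integrable g) :
    Integrable (fun p : Space d × Space d => f p.2 * g (p.2 - p.1)) (volume.prod volume) := by
  have := hf.convolution_integrand (ContinuousLinearMap.mul ℝ ℝ) hg.comp_neg
  simpa using this

theorem integrable_tiltedConv (hf : Integrable f) (hg : Integrable g) :
    Integrable (tiltedConv f g) :=
  (integrable_mul_sub hf hg).integral_prod_left

theorem integrable_conv (hκ : Integrable κ) (hg : Integrable g) :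
    Integrable (fun x => ∫ y, κ y * g (x - y)) :=
  hκ.integrable_convolution (ContinuousLinearMap.mul ℝ ℝ) hg

theorem fourierTr_conv (hκ : Integrable κ) (hg : Integrable g) (k : Space d) :
    fourierTr (fun x => ∫ y, κ y * g (x - y)) k = fourierTr κ k * fourierTr g k := by
  rw [fourierTr_eq, fourierTr_eq, fourierTr_eq]
  refine Eq.trans ?_ (Real.fourier_mul_convolution_eq (R := ℂ) hκ.ofReal hg.ofReal _)
  refine congrFun (congrArg FourierTransform.fourier (funext fun x => ?_)) _
  rw [convolution_def, ← integral_complex_ofReal]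
  simp

/-- Moving κ onto g makes the absolutely continuous part an L² pairing of f with κ ∗ g, to which
Plancherel applies. -/
theorem integral_tiltedConv_mul (hf : Integrable f) (hg : Measurable g) {c : ℝ}
    (hc : ∀ x, |g x| ≤ c) (hκ : Integrable κ) :
    ∫ y, tiltedConv f g y * κ y = ∫ x, f x * ∫ y, κ y * g (x - y) := by
  have hint : Integrable (fun p : Space d × Space d => g (p.2 - p.1) * (κ p.1 * f p.2))
      (volume.prod volume) := by
    refine (hκ.mul_prod hf).bdd_mul (c := c) ?_ (ae_of_all _ fun p => hc _)
    exact (hg.comp (measurable_snd.sub measurable_fst)).aestronglyMeasurable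
  calc ∫ y, tiltedConv f g y * κ y = ∫ y, ∫ x, g (x - y) * (κ y * f x) := by
        refine integral_congr_ae (ae_of_all _ fun y => ?_)
        beta_reduce
        rw [tiltedConv, ← integral_mul_const]
        exact integral_congr_ae (ae_of_all _ fun x => by ring)
    _ = ∫ x, ∫ y, g (x - y) * (κ y * f x) := integral_integral_swap hint
    _ = _ := by
        refine integral_congr_ae (ae_of_all _ fun x => ?_)
        beta_reduce
        rw [← integral_const_mul]
        exact integral_congr_ae (ae_of_all _ fun y => by ring)

end Convolution

variable {Ω : Type*} [MeasurableSpace Ω] {P : Measure Ω} {Φ : Ω → Measure (Space d)}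

/-- The additive identity is tested against f ⋆ g, whose value at the atom 0 is ∫fg. Integrability
against the reduced second moment measure is inherited from the explicit side. -/
theorem integral_tiltedConv_reducedSecondMoment {γ : ℝ≥0∞} {κ : Space d → ℝ≥0∞}
    (hγ : γ ≠ ∞) (hκ : ∫⁻ y, κ y ≠ ∞) (hκm : Measurable κ)
    (h : reducedSecondMoment P Φ + γ ^ 2 • volume.withDensity κ
      = γ • Measure.dirac 0 + γ ^ 2 • volume)
    {f g : Space d → ℝ} (hf : IsTestFunction f) (hg : IsTestFunction g) :
    (∫ y, tiltedConv f g y ∂(reducedSecondMoment P Φ)) - γ.toReal ^ 2 * ∫ y, tiltedConv f g y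
      = γ.toReal * (∫ x, f x * g x) - γ.toReal ^ 2 * ∫ y, tiltedConv f g y * (κ y).toReal := by
  obtain ⟨c, hc⟩ := hg.bounded
  have hi := integrable_tiltedConv hf.integrable hg.integrable
  have hm : Measurable (tiltedConv f g) := by
    have : StronglyMeasurable fun p : Space d × Space d => f p.2 * g (p.2 - p.1) :=
      ((hf.measurable.comp measurable_snd).mul
        (hg.measurable.comp (measurable_snd.sub measurable_fst))).stronglyMeasurable
    exact this.integral_prod_right'.measurable
  have hd : Integrable (tiltedConv f g) (Measure.dirac 0) :=
    integrable_dirac' hm.stronglyMeasurable (by simp)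
  have h1 : Integrable (tiltedConv f g) (γ • Measure.dirac 0) := hd.smul_measure hγ
  have h2 : Integrable (tiltedConv f g) (γ ^ 2 • volume) :=
    hi.smul_measure (ENNReal.pow_ne_top hγ)
  have h3 : Integrable (tiltedConv f g)
      (reducedSecondMoment P Φ + γ ^ 2 • volume.withDensity κ) := h ▸ h1.add_measure h2
  have key := congrArg (fun μ => ∫ y, tiltedConv f g y ∂μ) h
  rw [integral_add_measure h3.left_of_add_measure h3.right_of_add_measure,
    integral_add_measure h1 h2, integral_smul_measure, integral_smul_measure,
    integral_smul_measure, integral_dirac' _ _ hm.stronglyMeasurable, tiltedConv_zero,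
    integral_withDensity_eq_integral_toReal_smul hκm (ae_lt_top hκm hκ), ENNReal.toReal_pow] at key
  simp only [smul_eq_mul] at key
  simp_rw [mul_comm (tiltedConv f g _)]
  linarith

/-- The Bartlett spectral measure of a random measure whose covariance measure has an atom at the
origin and is otherwise absolutely continuous. -/
theorem isBartlettSpectralMeasure_of_add_eq {γ : ℝ≥0∞} {κ : Space d → ℝ≥0∞}
    (hγ : γ ≠ ∞) (hκ : ∫⁻ y, κ y ≠ ∞) (hκm : Measurable κ)
    (hi : intensity P Φ = γ)
    (h : reducedSecondMoment P Φ + γ ^ 2 • volume.withDensity κ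
      = γ • Measure.dirac 0 + γ ^ 2 • volume)
    {S : Space d → ℝ} (hS : Continuous S) (hS0 : ∀ k, 0 ≤ S k) (hS1 : ∀ k, S k ≤ 1)
    (hS' : ∀ k, (S k : ℂ) = 1 - γ.toReal * fourierTr (fun y => (κ y).toReal) k) :
    IsBartlettSpectralMeasure P Φ
      (volume.withDensity fun k => ENNReal.ofReal ((intensity P Φ).toReal * S k)) := by
  have hκi : Integrable fun y => (κ y).toReal :=
    integrable_toReal_of_lintegral_ne_top hκm.aemeasurable hκ
  have hSm : Measurable fun k => ENNReal.ofReal ((intensity P Φ).toReal * S k) :=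
    (hS.measurable.const_mul _).ennreal_ofReal
  have hfin : ∀ᵐ k : Space d, ENNReal.ofReal ((intensity P Φ).toReal * S k) < ∞ :=
    ae_of_all _ fun _ => ENNReal.ofReal_lt_top
  have hreal (k : Space d) : (ENNReal.ofReal ((intensity P Φ).toReal * S k)).toReal
      = γ.toReal * S k := by
    rw [hi, ENNReal.toReal_ofReal (mul_nonneg ENNReal.toReal_nonneg (hS0 k))]
  have hint {f g : Space d → ℝ} (hf : IsTestFunction f) (hg : IsTestFunction g) :
      Integrable (fun k => fourierTr f k * (starRingEnd ℂ) (fourierTr g k)) := by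
    obtain ⟨c, hc⟩ := hf.bounded
    obtain ⟨c', hc'⟩ := hg.bounded
    exact (plancherel_fourierTr hf.integrable (memLp_two_of_bounded hf.integrable hc)
      hg.integrable (memLp_two_of_bounded hg.integrable hc')).1
  refine ⟨?_, fun f g hf hg => ?_, fun f g hf hg => ?_⟩
  · exact IsLocallyFiniteMeasure.withDensity_ofReal (continuous_const.mul hS)
  · rw [integrable_withDensity_iff_integrable_smul' hSm hfin]
    simp_rw [hreal, Complex.real_smul]
    refine (hint hf hg).bdd_mul (c := γ.toReal * 1) ?_ (ae_of_all _ fun k => ?_)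
    · exact (Complex.continuous_ofReal.comp (continuous_const.mul hS)).aestronglyMeasurable
    · rw [Complex.norm_real, Real.norm_of_nonneg (mul_nonneg ENNReal.toReal_nonneg (hS0 k))]
      exact mul_le_mul_of_nonneg_left (hS1 k) ENNReal.toReal_nonneg
  · obtain ⟨c, hc⟩ := hf.bounded
    obtain ⟨c', hc'⟩ := hg.bounded
    set q : Space d → ℝ := fun x => ∫ y, (κ y).toReal * g (x - y) with hq
    have hqi : Integrable q := integrable_conv hκi hg.integrable
    have hqb (x : Space d) : |q x| ≤ (∫ y, |(κ y).toReal|) * c' := by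
      rw [hq, ← integral_mul_const]
      rw [← Real.norm_eq_abs]
      refine norm_integral_le_of_norm_le (hκi.abs.mul_const c') (ae_of_all _ fun y => ?_)
      rw [norm_mul]
      exact mul_le_mul_of_nonneg_left (hc' _) (norm_nonneg _)
    have hf2 := memLp_two_of_bounded hf.integrable hc
    obtain ⟨-, e1⟩ := plancherel_fourierTr hf.integrable hf2 hg.integrable
      (memLp_two_of_bounded hg.integrable hc')
    obtain ⟨e2i, e2⟩ := plancherel_fourierTr hf.integrable hf2 hqi (memLp_two_of_bounded hqi hqb)
    rw [hi, integral_tiltedConv_reducedSecondMoment hγ hκ hκm h hf hg,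
      integral_tiltedConv_mul hf.integrable hg.measurable hc' hκi, ← hi,
      integral_withDensity_eq_integral_toReal_smul hSm hfin]
    simp_rw [hreal, Complex.real_smul]
    rw [hi, Complex.ofReal_sub, Complex.ofReal_mul, Complex.ofReal_mul, e1, e2]
    -- Plancherel conjugates the transform of κ ∗ g, so κ̂ appears conjugated. As S is real, the
    -- formula for S survives conjugation.
    have hconj (k : Space d) : (starRingEnd ℂ) (fourierTr (fun y => (κ y).toReal) k)
        * (γ.toReal : ℂ) = 1 - S k := by
      have := congrArg (starRingEnd ℂ) (hS' k)
      simp only [Complex.conj_ofReal, map_sub, map_one, map_mul] at this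
      rw [this]; ring
    have hpt (k : Space d) : (γ.toReal * S k : ℝ) * (fourierTr f k * (starRingEnd ℂ) (fourierTr g k))
        = γ.toReal * (fourierTr f k * (starRingEnd ℂ) (fourierTr g k))
          - γ.toReal ^ 2 * (fourierTr f k * (starRingEnd ℂ) (fourierTr q k)) := by
      rw [hq, fourierTr_conv hκi hg.integrable, map_mul]
      push_cast
      linear_combination (γ.toReal * fourierTr f k * (starRingEnd ℂ) (fourierTr g k)) * hconj k
    simp_rw [hpt]
    rw [integral_sub ((hint hf hg).const_mul _) (e2i.const_mul _), integral_const_mul,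
      integral_const_mul]
    push_cast
    ring

end RandomMeasures

/-! ### The Fourier transform of the zero cell -/

namespace RandomMeasures

variable {Ω : Type*} [MeasurableSpace Ω] {d : ℕ}

theorem fourierTr_indicator_preimage_add (C : Set (Space d)) (y k : Space d) :
    fourierTr (((fun x => x + y) ⁻¹' C).indicator fun _ => (1 : ℝ)) k
      = Complex.exp (Complex.I * ((inner ℝ k y : ℝ) : ℂ)) *
        fourierTr (C.indicator fun _ => (1 : ℝ)) k := by
  rw [fourierTr, fourierTr, ← integral_const_mul]
  rw [← integral_add_right_eq_self (fun x => Complex.exp (Complex.I * ((inner ℝ k y : ℝ) : ℂ)) *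
    (((C.indicator (fun _ => (1 : ℝ)) x : ℝ) : ℂ) *
      Complex.exp (-(Complex.I * ((inner ℝ k x : ℝ) : ℂ))))) y]
  refine integral_congr_ae (ae_of_all _ fun x => ?_)
  beta_reduce
  rw [mul_left_comm, ← Complex.exp_add]
  congr 2
  rw [inner_add_right]
  push_cast
  ring

theorem indicatorFourierSq_preimage_add (C : Set (Space d)) (y k : Space d) :
    indicatorFourierSq ((fun x => x + y) ⁻¹' C) k = indicatorFourierSq C k := by
  rw [indicatorFourierSq, indicatorFourierSq, fourierTr_indicator_preimage_add, norm_mul,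
    mul_comm Complex.I, Complex.norm_exp_ofReal_mul_I, one_mul]

theorem norm_fourierTr_indicator_le {C : Set (Space d)} (hC : MeasurableSet C) (k : Space d) :
    ‖fourierTr (C.indicator fun _ => (1 : ℝ)) k‖ ≤ volume.real C := by
  refine (norm_fourierTr_le _ k).trans_eq ?_
  rw [← integral_indicator_one hC]
  refine integral_congr_ae (ae_of_all _ fun x => ?_)
  by_cases hx : x ∈ C <;> simp [hx]

theorem measurable_fourierTr_indicator {C : Ω → Set (Space d)}
    (hC : MeasurableSet {p : Ω × Space d | p.2 ∈ C p.1}) (k : Space d) :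
    Measurable fun ω => fourierTr ((C ω).indicator fun _ => (1 : ℝ)) k := by
  have h1 : Measurable fun p : Ω × Space d => (C p.1).indicator (fun _ => (1 : ℝ)) p.2 :=
    (measurable_const (a := (1 : ℝ))).indicator hC
  have h2 : Continuous fun x : Space d => Complex.exp (-(Complex.I * ((inner ℝ k x : ℝ) : ℂ))) := by
    fun_prop
  have h3 : Measurable fun p : Ω × Space d => (((C p.1).indicator (fun _ => (1 : ℝ)) p.2 : ℝ) : ℂ) *
      Complex.exp (-(Complex.I * ((inner ℝ k p.2 : ℝ) : ℂ))) :=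
    (Complex.measurable_ofReal.comp h1).mul (h2.measurable.comp measurable_snd)
  exact h3.stronglyMeasurable.integral_prod_right'.measurable

theorem measurable_indicatorFourierSq {C : Ω → Set (Space d)}
    (hC : MeasurableSet {p : Ω × Space d | p.2 ∈ C p.1}) (k : Space d) :
    Measurable fun ω => indicatorFourierSq (C ω) k :=
  (measurable_fourierTr_indicator hC k).norm.pow_const 2

variable [AddAction (Space d) Ω]
  {P : Measure Ω} {Ψ : Ω → Measure (Space d)} {τ : Ω → Space d → Option (Space d)}

namespace IsInvariantPartition

theorem measurableSet_mem_zeroCell (h : IsInvariantPartition P Ψ τ) :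
    MeasurableSet {p : Ω × Space d | p.2 ∈ zeroCell τ p.1} :=
  h.measurableSet_eq measurable_fst measurable_snd measurable_const

theorem zeroCell_vadd (h : IsInvariantPartition P Ψ τ) (ω : Ω) (y : Space d) :
    zeroCell τ (y +ᵥ ω) = (fun x => x + y) ⁻¹' {x | τ ω x = τ ω y} := by
  ext x
  have := h.allocation_vadd_eq_iff ω (x + y) y y
  rw [add_sub_cancel_right, sub_self] at this
  exact this

theorem neg_mem_zeroCell_vadd (h : IsInvariantPartition P Ψ τ) (ω : Ω) (y : Space d) :
    -y ∈ zeroCell τ (y +ᵥ ω) ↔ y ∈ zeroCell τ ω := by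
  rw [h.zeroCell_vadd, Set.mem_preimage, neg_add_cancel, Set.mem_ofPred_eq, eq_comm]
  rfl

theorem fourierTr_zeroCell_vadd (h : IsInvariantPartition P Ψ τ) {ω : Ω} {y : Space d}
    (hy : y ∈ zeroCell τ ω) (k : Space d) :
    fourierTr ((zeroCell τ (y +ᵥ ω)).indicator fun _ => (1 : ℝ)) k
      = Complex.exp (Complex.I * ((inner ℝ k y : ℝ) : ℂ)) *
        fourierTr ((zeroCell τ ω).indicator fun _ => (1 : ℝ)) k := by
  rw [h.zeroCell_vadd, fourierTr_indicator_preimage_add]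
  have : {x | τ ω x = τ ω y} = zeroCell τ ω := by
    ext x
    rw [zeroCell, Set.mem_ofPred_eq, Set.mem_ofPred_eq, show τ ω y = τ ω 0 from hy]
  rw [this]

/-- With a = 1̂_{V₀}(k), expand the second factor of a·ā as the integral of e^{i⟨k,y⟩} over V₀. For
y ∈ V₀ this phase times a is the value of a at the shifted configuration. -/
theorem indicatorFourierSq_zeroCell_eq_integral (h : IsInvariantPartition P Ψ τ) (ω : Ω)
    (k : Space d) :
    (indicatorFourierSq (zeroCell τ ω) k : ℂ) = ∫ y, (zeroCell τ ω).indicator (fun y =>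
      fourierTr ((zeroCell τ (y +ᵥ ω)).indicator fun _ => (1 : ℝ)) k) y := by
  rw [indicatorFourierSq, ← Complex.normSq_eq_norm_sq, ← Complex.mul_conj]
  nth_rewrite 2 [fourierTr]
  rw [← integral_conj, ← integral_const_mul]
  refine integral_congr_ae (ae_of_all _ fun y => ?_)
  beta_reduce
  by_cases hy : y ∈ zeroCell τ ω
  · rw [Set.indicator_of_mem hy, Set.indicator_of_mem hy, h.fourierTr_zeroCell_vadd hy,
      mul_comm, Complex.ofReal_one, one_mul, ← Complex.exp_conj]
    simp
  · simp [hy]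

theorem norm_fourierTr_zeroCell_le (h : IsInvariantPartition P Ψ τ) (hf : IsFair P Ψ τ)
    (k : Space d) : ∀ᵐ ω ∂P, ‖fourierTr ((zeroCell τ ω).indicator fun _ => (1 : ℝ)) k‖
      ≤ (intensity P Ψ).toReal⁻¹ := by
  filter_upwards [h.volume_zeroCell hf] with ω hω
  refine (norm_fourierTr_indicator_le (h.measurableSet_zeroCell ω) k).trans_eq ?_
  rw [measureReal_def, zeroCell, hω 0, ENNReal.toReal_inv]

/-- Justifies the Fubini exchanges: the integrand is bounded and {(ω, y) : y ∈ V₀} has finite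
measure γ⁻¹. -/
theorem integrable_indicator_mul_fourierTr [IsProbabilityMeasure P]
    (h : IsInvariantPartition P Ψ τ) (hf : IsFair P Ψ τ) (h0 : intensity P Ψ ≠ 0)
    {e : Space d → ℂ} (he : Continuous e) (he1 : ∀ y, ‖e y‖ ≤ 1)
    {b : Ω → ℂ} (hb : Measurable b) {c : ℝ} (hc : ∀ᵐ ω ∂P, ‖b ω‖ ≤ c) :
    Integrable (fun p : Ω × Space d => (zeroCell τ p.1).indicator (fun y => e y * b p.1) p.2)
      (P.prod volume) := by
  have hS := h.measurableSet_mem_zeroCell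
  have hfin : (P.prod volume) {p : Ω × Space d | p.2 ∈ zeroCell τ p.1} ≠ ∞ := by
    rw [Measure.prod_apply_symm hS]
    exact (h.lintegral_coverProb hf).trans_ne (ENNReal.inv_ne_top.2 h0)
  have hm : Measurable fun p : Ω × Space d => e p.2 * b p.1 :=
    (he.measurable.comp measurable_snd).mul (hb.comp measurable_fst)
  have hon : IntegrableOn (fun p : Ω × Space d => e p.2 * b p.1)
      {p : Ω × Space d | p.2 ∈ zeroCell τ p.1} (P.prod volume) := by
    refine Measure.integrableOn_of_bounded (M := 1 * c) hfin hm.aestronglyMeasurable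
      (ae_restrict_of_ae ?_)
    filter_upwards [Measure.quasiMeasurePreserving_fst.ae hc] with p hp
    rw [norm_mul]
    exact mul_le_mul (he1 _) hp (norm_nonneg _) zero_le_one
  exact (integrable_indicator_iff hS).2 hon

/-- The mean of the Fourier transform of the zero cell. -/
theorem integral_fourierTr_zeroCell [IsProbabilityMeasure P] (h : IsInvariantPartition P Ψ τ)
    (hf : IsFair P Ψ τ) (h0 : intensity P Ψ ≠ 0) (k : Space d) :
    ∫ ω, fourierTr ((zeroCell τ ω).indicator fun _ => (1 : ℝ)) k ∂P
      = fourierTr (fun y => (coverProb P τ y).toReal) k := by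
  have hnorm (y : Space d) : ‖Complex.exp (-(Complex.I * ((inner ℝ k y : ℝ) : ℂ)))‖ ≤ 1 := by
    have : -(Complex.I * ((inner ℝ k y : ℝ) : ℂ)) = ((-(inner ℝ k y : ℝ) : ℝ) : ℂ) * Complex.I := by
      push_cast; ring
    rw [this, Complex.norm_exp_ofReal_mul_I]
  have hint := h.integrable_indicator_mul_fourierTr hf h0
    (e := fun y => Complex.exp (-(Complex.I * ((inner ℝ k y : ℝ) : ℂ)))) (by fun_prop)
    hnorm (b := fun _ => 1) measurable_const (c := 1) (by simp)
  calc _ = ∫ ω, (∫ y, (zeroCell τ ω).indicator (fun y =>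
          Complex.exp (-(Complex.I * ((inner ℝ k y : ℝ) : ℂ))) * 1) y) ∂P := by
        refine integral_congr_ae (ae_of_all _ fun ω => ?_)
        refine integral_congr_ae (ae_of_all _ fun y => ?_)
        by_cases hy : y ∈ zeroCell τ ω <;> simp [hy]
    _ = ∫ y, (∫ ω, (zeroCell τ ω).indicator (fun y =>
          Complex.exp (-(Complex.I * ((inner ℝ k y : ℝ) : ℂ))) * 1) y ∂P) :=
        integral_integral_swap hint
    _ = _ := by
        refine integral_congr_ae (ae_of_all _ fun y => ?_)
        have hS : MeasurableSet {ω | y ∈ zeroCell τ ω} :=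
          h.measurableSet_eq measurable_id measurable_const measurable_const
        beta_reduce
        have : ∀ ω, (zeroCell τ ω).indicator (fun y =>
            Complex.exp (-(Complex.I * ((inner ℝ k y : ℝ) : ℂ))) * 1) y
            = {ω | y ∈ zeroCell τ ω}.indicator (fun _ =>
              Complex.exp (-(Complex.I * ((inner ℝ k y : ℝ) : ℂ)))) ω := fun ω => by
          by_cases hy : y ∈ zeroCell τ ω <;> simp [hy]
        simp_rw [this]
        rw [integral_indicator_const _ hS, Complex.real_smul]
        rfl

variable [MeasurableVAdd₂ (Space d) Ω] [VAddInvariantMeasure (Space d) Ω P]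

/-- The mean squared modulus of the Fourier transform of the zero cell. -/
theorem integral_indicatorFourierSq_zeroCell [IsProbabilityMeasure P]
    (h : IsInvariantPartition P Ψ τ)
    (hf : IsFair P Ψ τ) (h0 : intensity P Ψ ≠ 0) (k : Space d) :
    ((∫ ω, indicatorFourierSq (zeroCell τ ω) k ∂P : ℝ) : ℂ)
      = ((intensity P Ψ).toReal : ℂ)⁻¹ * fourierTr (fun y => (coverProb P τ y).toReal) k := by
  set a : Ω → ℂ := fun ω => fourierTr ((zeroCell τ ω).indicator fun _ => (1 : ℝ)) k with ha
  have ham : Measurable a := measurable_fourierTr_indicator h.measurableSet_mem_zeroCell k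
  have hab := h.norm_fourierTr_zeroCell_le hf k
  have hnorm (y : Space d) : ‖Complex.exp (Complex.I * ((inner ℝ k y : ℝ) : ℂ))‖ ≤ 1 := by
    rw [mul_comm, Complex.norm_exp_ofReal_mul_I]
  have hint := h.integrable_indicator_mul_fourierTr hf h0
    (e := fun y => Complex.exp (Complex.I * ((inner ℝ k y : ℝ) : ℂ))) (by fun_prop)
    hnorm ham hab
  have hint' := h.integrable_indicator_mul_fourierTr hf h0
    (e := fun y => 1) (by fun_prop) (by simp) ham hab
  calc ((∫ ω, indicatorFourierSq (zeroCell τ ω) k ∂P : ℝ) : ℂ)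
      = ∫ ω, (∫ y, (zeroCell τ ω).indicator (fun y => a (y +ᵥ ω)) y) ∂P := by
        rw [← integral_complex_ofReal]
        exact integral_congr_ae (ae_of_all _ fun ω =>
          h.indicatorFourierSq_zeroCell_eq_integral ω k)
    _ = ∫ y, (∫ ω, (zeroCell τ ω).indicator (fun y => a (y +ᵥ ω)) y ∂P) := by
        refine integral_integral_swap (hint.congr (ae_of_all _ fun p => ?_))
        by_cases hy : p.2 ∈ zeroCell τ p.1
        · simp only [Function.uncurry, Set.indicator_of_mem hy]
          exact (h.fourierTr_zeroCell_vadd hy k).symm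
        · simp only [Function.uncurry, Set.indicator_of_notMem hy]
    -- Mass transport: y ∈ V₀ exactly when -y lies in the zero cell of the configuration shifted by
    -- y, and the shift preserves P.
    _ = ∫ y, (∫ ω, (zeroCell τ ω).indicator (fun _ => a ω) (-y) ∂P) := by
        refine integral_congr_ae (ae_of_all _ fun y => ?_)
        beta_reduce
        rw [← (measurePreserving_vadd y P).integral_comp (measurableEmbedding_const_vadd y)
          (fun ω => (zeroCell τ ω).indicator (fun _ => a ω) (-y))]
        refine integral_congr_ae (ae_of_all _ fun ω => ?_)
        have := h.neg_mem_zeroCell_vadd ω y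
        by_cases hy : y ∈ zeroCell τ ω
        · simp only [Set.indicator_of_mem hy, Set.indicator_of_mem (this.2 hy)]
        · simp only [Set.indicator_of_notMem hy, Set.indicator_of_notMem (mt this.1 hy)]
    _ = ∫ y, (∫ ω, (zeroCell τ ω).indicator (fun _ => 1 * a ω) y ∂P) := by
        simp_rw [one_mul]
        exact integral_neg_eq_self (fun y => ∫ ω, (zeroCell τ ω).indicator (fun _ => a ω) y ∂P) _
    _ = ∫ ω, (∫ y, (zeroCell τ ω).indicator (fun _ => 1 * a ω) y) ∂P :=
        (integral_integral_swap hint').symm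
    -- The inner integrand is constant in y on V₀, so fairness produces the factor γ⁻¹.
    _ = ∫ ω, ((intensity P Ψ).toReal : ℂ)⁻¹ * a ω ∂P := by
        refine integral_congr_ae ?_
        filter_upwards [h.volume_zeroCell hf] with ω hω
        rw [integral_indicator_const _ (h.measurableSet_zeroCell ω), measureReal_def, zeroCell,
          hω 0, ENNReal.toReal_inv, Complex.real_smul, one_mul]
        push_cast
        rfl
    _ = _ := by
        rw [integral_const_mul, ha, h.integral_fourierTr_zeroCell hf h0]

end IsInvariantPartition

end RandomMeasures

/-! ### The Palm expectation -/

namespace RandomMeasures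

variable {Ω : Type*} [MeasurableSpace Ω] {d : ℕ}

theorem indicatorFourierSq_nonneg (C : Set (Space d)) (k : Space d) :
    0 ≤ indicatorFourierSq C k := sq_nonneg _

variable [AddAction (Space d) Ω]
  {P : Measure Ω} {Ψ : Ω → Measure (Space d)} {τ : Ω → Space d → Option (Space d)}
  {X : ℕ → Ω → Space d}

namespace IsInvariantPartition

theorem cell_vadd_zero (h : IsInvariantPartition P Ψ τ) (ω : Ω) (x : Space d) :
    cell τ (x +ᵥ ω) 0 = (fun y => y + x) ⁻¹' cell τ ω x := by
  ext y
  rw [← sub_self x, h.mem_cell_vadd, Set.mem_preimage]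

theorem indicatorFourierSq_zeroCell_vadd (h : IsInvariantPartition P Ψ τ) {ω : Ω}
    {x y : Space d} (hy : y ∈ cell τ ω x) (k : Space d) :
    indicatorFourierSq (zeroCell τ (y +ᵥ ω)) k = indicatorFourierSq (cell τ (x +ᵥ ω) 0) k := by
  have : {z | τ ω z = τ ω y} = cell τ ω x := by
    ext z
    rw [cell, Set.mem_ofPred_eq, Set.mem_ofPred_eq, show τ ω y = some x from hy]
  rw [h.zeroCell_vadd, h.cell_vadd_zero, this, indicatorFourierSq_preimage_add,
    indicatorFourierSq_preimage_add]

variable [MeasurableVAdd₂ (Space d) Ω]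

/-- The refined Campbell formula for the Palm probability measure. -/
theorem lintegral_palm (h : IsInvariantPartition P Ψ τ) (hX : IsEnumeration P Ψ X)
    {f : Ω → ℝ≥0∞} (hf : Measurable f) :
    ∫⁻ ω, f ω ∂(palm P Ψ) = (intensity P Ψ)⁻¹ *
      ∫⁻ ω, ∑' n, (unitCube d).indicator (fun x => f (x +ᵥ ω)) (X n ω) ∂P := by
  have hv (ω : Ω) : Measurable fun x : Space d => x +ᵥ ω := measurable_vadd_const ω
  have hlint {g : Ω → ℝ≥0∞} (hg : Measurable g) (ω : Ω) :
      ∫⁻ ω', g ω' ∂(((pointMeasure fun n => X n ω).restrict (unitCube d)).map fun x => x +ᵥ ω)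
        = ∑' n, (unitCube d).indicator (fun x => g (x +ᵥ ω)) (X n ω) := by
    have hgv : Measurable fun x : Space d => g (x +ᵥ ω) := hg.comp (hv ω)
    rw [lintegral_map hg (hv ω), ← lintegral_indicator measurableSet_unitCube,
      lintegral_pointMeasure _ (hgv.indicator measurableSet_unitCube)]
  have hae : (fun ω => ((Ψ ω).restrict (unitCube d)).map fun x => x +ᵥ ω) =ᵐ[P] fun ω =>
      ((pointMeasure fun n => X n ω).restrict (unitCube d)).map fun x => x +ᵥ ω := by
    filter_upwards [hX.ae_eq_pointMeasure h] with ω hω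
    rw [hω]
  have hm : Measurable fun ω =>
      ((pointMeasure fun n => X n ω).restrict (unitCube d)).map fun x => x +ᵥ ω := by
    refine Measure.measurable_of_measurable_coe _ fun S hS => ?_
    have hS' : Measurable (S.indicator (1 : Ω → ℝ≥0∞)) := measurable_one.indicator hS
    simp_rw [← lintegral_indicator_one hS, hlint hS']
    refine .tsum fun n => ?_
    have : (fun ω => (unitCube d).indicator (fun x => S.indicator (1 : Ω → ℝ≥0∞) (x +ᵥ ω)) (X n ω))
        = (X n ⁻¹' unitCube d).indicator fun ω => S.indicator 1 (X n ω +ᵥ ω) := by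
      funext ω
      by_cases hx : X n ω ∈ unitCube d <;> simp [hx]
    rw [this]
    exact (hS'.comp ((hX.measurable n).vadd measurable_id)).indicator
      (hX.measurable n measurableSet_unitCube)
  rw [palm, lintegral_smul_measure, smul_eq_mul, Measure.bind_congr_right hae,
    Measure.lintegral_bind hm.aemeasurable hf.aemeasurable]
  simp_rw [hlint hf]

/-- Each centre is spread uniformly over its cell, on which the functional is constant when seen
from any of its points. Invariance then moves the spread point to the origin. -/
theorem lintegral_indicatorFourierSq_palm [IsProbabilityMeasure P]
    [VAddInvariantMeasure (Space d) Ω P] (h : IsInvariantPartition P Ψ τ)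
    (hX : IsEnumeration P Ψ X) (hf : IsFair P Ψ τ) (h0 : intensity P Ψ ≠ 0) (k : Space d) :
    ∫⁻ ω, ENNReal.ofReal (indicatorFourierSq (cell τ ω 0) k) ∂(palm P Ψ)
      = ∫⁻ ω, ENNReal.ofReal (indicatorFourierSq (zeroCell τ ω) k) ∂P := by
  set A : Ω → ℝ≥0∞ := fun ω => ENNReal.ofReal (indicatorFourierSq (zeroCell τ ω) k) with hA
  have hAm : Measurable A :=
    (measurable_indicatorFourierSq h.measurableSet_mem_zeroCell k).ennreal_ofReal
  have hcm : Measurable fun ω => ENNReal.ofReal (indicatorFourierSq (cell τ ω 0) k) :=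
    (measurable_indicatorFourierSq (C := fun ω => cell τ ω 0)
      (h.measurableSet_eq_some measurable_fst measurable_snd measurable_const) k).ennreal_ofReal
  have hgm := h.measurable_getD
  have hQ : Measurable fun p : Ω × Space d => A (p.2 +ᵥ p.1) := hAm.comp (by fun_prop)
  have hR : Measurable fun p : Ω × Space d =>
      (unitCube d).indicator (fun _ => A (p.2 +ᵥ p.1)) ((τ p.1 p.2).getD 0) :=
    hQ.indicator (s := {p : Ω × Space d | (τ p.1 p.2).getD 0 ∈ unitCube d})
      (hgm measurableSet_unitCube)
  have e1 : ∀ᵐ ω ∂P, ∑' n, (unitCube d).indicator (fun x =>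
        ENNReal.ofReal (indicatorFourierSq (cell τ (x +ᵥ ω) 0) k)) (X n ω)
      = intensity P Ψ * ∫⁻ y, (unitCube d).indicator (fun _ => A (y +ᵥ ω)) ((τ ω y).getD 0) := by
    filter_upwards [hX.range_eq, hf, h.tsum_setLIntegral_cell hX] with ω h1 h2 h3
    rw [← h3, ← ENNReal.tsum_mul_left]
    refine tsum_congr fun n => ?_
    have : ∫⁻ y in cell τ ω (X n ω),
          (unitCube d).indicator (fun _ => A (y +ᵥ ω)) ((τ ω y).getD 0)
        = ∫⁻ y in cell τ ω (X n ω), (unitCube d).indicator (fun x =>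
          ENNReal.ofReal (indicatorFourierSq (cell τ (x +ᵥ ω) 0) k)) (X n ω) := by
      refine setLIntegral_congr_fun (h.measurableSet_cell _ _) fun y hy => ?_
      have hy' : τ ω y = some (X n ω) := hy
      simp only [hA, h.indicatorFourierSq_zeroCell_vadd hy, hy', Option.getD_some]
      by_cases hx : X n ω ∈ unitCube d <;> simp [hx]
    rw [this, setLIntegral_const, h2 _ (h1 ▸ ⟨n, rfl⟩), mul_comm, mul_assoc,
      ENNReal.inv_mul_cancel h0 h.intensity_ne_top, mul_one]
  rw [h.lintegral_palm hX hcm, lintegral_congr_ae e1, lintegral_const_mul _ hR.lintegral_prod_right',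
    ← mul_assoc, ENNReal.inv_mul_cancel h0 h.intensity_ne_top, one_mul,
    lintegral_lintegral_swap hR.aemeasurable]
  -- After the shift the centre of the cell of y is τ(0) + y, and the functional no longer depends
  -- on y. Integrating over y then gives the volume of the cube, which is 1.
  have e2 (y : Space d) :
      ∫⁻ ω, (unitCube d).indicator (fun _ => A (y +ᵥ ω)) ((τ ω y).getD 0) ∂P
        = ∫⁻ ω, (unitCube d).indicator (fun _ => A ω) ((τ ω 0).getD 0 + y) ∂P := by
    rw [← lintegral_vadd y
      (fun ω => (unitCube d).indicator (fun _ => A ω) ((τ ω 0).getD 0 + y))]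
    refine lintegral_congr_ae ?_
    filter_upwards [h.ae_ne_zero] with ω hω
    obtain ⟨z, -, hz⟩ := h.allocation_mem ω hω y
    have := h.equivariant ω y y
    rw [sub_self, hz] at this
    simp [this, hz]
  simp_rw [e2]
  have hT : Measurable fun p : Space d × Ω =>
      (unitCube d).indicator (fun _ => A p.2) ((τ p.2 0).getD 0 + p.1) := by
    have hs : Measurable fun p : Space d × Ω => (τ p.2 0).getD 0 + p.1 :=
      (hgm.comp (by fun_prop : Measurable fun p : Space d × Ω => (p.2, (0 : Space d)))).add
        measurable_fst
    exact (hAm.comp measurable_snd).indicator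
      (s := {p : Space d × Ω | (τ p.2 0).getD 0 + p.1 ∈ unitCube d}) (hs measurableSet_unitCube)
  rw [lintegral_lintegral_swap hT.aemeasurable]
  refine lintegral_congr fun ω => ?_
  rw [lintegral_add_left_eq_self (fun y => (unitCube d).indicator (fun _ => A ω) y),
    lintegral_indicator_const measurableSet_unitCube, volume_unitCube, mul_one]

theorem integral_indicatorFourierSq_palm [IsProbabilityMeasure P]
    [VAddInvariantMeasure (Space d) Ω P] (h : IsInvariantPartition P Ψ τ)
    (hX : IsEnumeration P Ψ X) (hf : IsFair P Ψ τ) (h0 : intensity P Ψ ≠ 0) (k : Space d) :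
    ∫ ω, indicatorFourierSq (cell τ ω 0) k ∂(palm P Ψ)
      = ∫ ω, indicatorFourierSq (zeroCell τ ω) k ∂P := by
  have hcm : Measurable fun ω => indicatorFourierSq (cell τ ω 0) k :=
    measurable_indicatorFourierSq (C := fun ω => cell τ ω 0)
      (h.measurableSet_eq_some measurable_fst measurable_snd measurable_const) k
  have hzm : Measurable fun ω => indicatorFourierSq (zeroCell τ ω) k :=
    measurable_indicatorFourierSq h.measurableSet_mem_zeroCell k
  rw [integral_eq_lintegral_of_nonneg_ae (ae_of_all _ fun _ => indicatorFourierSq_nonneg _ _)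
    hcm.aestronglyMeasurable, integral_eq_lintegral_of_nonneg_ae
    (ae_of_all _ fun _ => indicatorFourierSq_nonneg _ _) hzm.aestronglyMeasurable,
    h.lintegral_indicatorFourierSq_palm hX hf h0]

end IsInvariantPartition

end RandomMeasures

/-! ### Variance asymptotics and hyperuniformity -/

namespace RandomMeasures

variable {Ω : Type*} [MeasurableSpace Ω] {d : ℕ}

/-- The part of `B` that leaves `B` under translation by `z`. -/
def leavingSet (B : Set (Space d)) (z : Space d) : Set (Space d) := {x | x ∈ B ∧ x + z ∉ B}

theorem measurable_volume_leavingSet {B : Set (Space d)} (hB : MeasurableSet B) :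
    Measurable fun z => volume (leavingSet B z) :=
  measurable_measure_prodMk_left
    (s := {p : Space d × Space d | p.2 ∈ B} ∩ {p : Space d × Space d | p.2 + p.1 ∈ B}ᶜ)
    ((measurable_snd hB).inter ((measurable_snd.add measurable_fst) hB).compl)

/-- Substitute z = y - x. For fixed z, the set B splits into the points whose translate stays in B
and those that leave. -/
theorem lintegral_lintegral_sub_add (κ : Space d → ℝ≥0∞) (hκ : Measurable κ)
    {B : Set (Space d)} (hB : MeasurableSet B) :
    (∫⁻ x in B, ∫⁻ y in B, κ (y - x)) + ∫⁻ z, κ z * volume (leavingSet B z)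
      = (∫⁻ z, κ z) * volume B := by
  have e1 : ∫⁻ x in B, ∫⁻ y in B, κ (y - x) = ∫⁻ z, κ z * volume {x | x ∈ B ∧ x + z ∈ B} := by
    have hS : MeasurableSet {p : Space d × Space d | p.1 ∈ B ∧ p.1 + p.2 ∈ B} :=
      (measurable_fst hB).inter ((measurable_fst.add measurable_snd) hB)
    have hm : Measurable fun p : Space d × Space d =>
        {p : Space d × Space d | p.1 ∈ B ∧ p.1 + p.2 ∈ B}.indicator (fun p => κ p.2) p :=
      (hκ.comp measurable_snd).indicator hS
    calc ∫⁻ x in B, ∫⁻ y in B, κ (y - x)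
        = ∫⁻ x, ∫⁻ z, {p : Space d × Space d | p.1 ∈ B ∧ p.1 + p.2 ∈ B}.indicator
            (fun p => κ p.2) (x, z) := by
          rw [← lintegral_indicator hB]
          refine lintegral_congr fun x => ?_
          by_cases hx : x ∈ B
          · rw [Set.indicator_of_mem hx, ← lintegral_indicator hB,
              ← lintegral_add_left_eq_self _ x]
            refine lintegral_congr fun z => ?_
            by_cases hz : x + z ∈ B <;> simp [hx, hz]
          · simp [hx]
      _ = ∫⁻ z, ∫⁻ x, {p : Space d × Space d | p.1 ∈ B ∧ p.1 + p.2 ∈ B}.indicator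
            (fun p => κ p.2) (x, z) := lintegral_lintegral_swap hm.aemeasurable
      _ = _ := by
          refine lintegral_congr fun z => ?_
          have hz : MeasurableSet {x | x ∈ B ∧ x + z ∈ B} :=
            hB.inter ((measurable_add_const z) hB)
          rw [← lintegral_indicator_const hz]
          rfl
  have hm : Measurable fun z => κ z * volume (leavingSet B z) :=
    hκ.mul (measurable_volume_leavingSet hB)
  rw [e1, ← lintegral_add_right _ hm,
    ← lintegral_mul_const _ hκ]
  refine lintegral_congr fun z => ?_
  rw [← mul_add]
  congr 1
  exact measure_inter_add_sdiff B ((measurable_add_const z) hB)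

/-- The leaving points lie in a shell of width ‖z‖ at the boundary, whose share of the ball is 1 -
(1 - ‖z‖/r)^d. -/
theorem tendsto_volume_leavingSet_closedBall (z : Space d) :
    Tendsto (fun r : ℝ => volume (leavingSet (Metric.closedBall 0 r) z) /
      volume (Metric.closedBall (0 : Space d) r)) atTop (𝓝 0) := by
  have hlim : Tendsto (fun r : ℝ => ENNReal.ofReal (1 - (1 - ‖z‖ / r) ^ d)) atTop (𝓝 0) := by
    have h1 : Tendsto (fun r : ℝ => ‖z‖ / r) atTop (𝓝 0) := tendsto_const_nhds.div_atTop tendsto_id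
    have h2 := ENNReal.tendsto_ofReal ((h1.const_sub 1).pow d |>.const_sub 1)
    simpa using h2
  refine tendsto_of_tendsto_of_tendsto_of_le_of_le' tendsto_const_nhds hlim
    (Eventually.of_forall fun _ => zero_le) ?_
  filter_upwards [eventually_gt_atTop ‖z‖] with r hr
  have hr0 : 0 < r := (norm_nonneg z).trans_lt hr
  set v := volume (Metric.ball (0 : Space d) 1) with hv
  have hv0 : v ≠ 0 := (Metric.measure_ball_pos _ _ one_pos).ne'
  have hvt : v ≠ ∞ := measure_ball_lt_top.ne
  have hvol {s : ℝ} (hs : 0 ≤ s) : volume (Metric.closedBall (0 : Space d) s)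
      = ENNReal.ofReal (s ^ d) * v := by
    rw [Measure.addHaar_closedBall _ _ hs, finrank_euclideanSpace_fin]
  have hsub : leavingSet (Metric.closedBall 0 r) z
      ⊆ Metric.closedBall (0 : Space d) r \ Metric.closedBall 0 (r - ‖z‖) := by
    rintro x ⟨hx, hxz⟩
    refine ⟨hx, fun hx' => hxz ?_⟩
    rw [mem_closedBall_zero_iff] at hx' ⊢
    linarith [norm_add_le x z]
  have hle : volume (leavingSet (Metric.closedBall 0 r) z)
      ≤ ENNReal.ofReal (r ^ d - (r - ‖z‖) ^ d) * v := by
    refine (measure_mono hsub).trans_eq ?_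
    rw [measure_sdiff (Metric.closedBall_subset_closedBall (by linarith [norm_nonneg z]))
      Metric.isClosed_closedBall.measurableSet.nullMeasurableSet
      (measure_closedBall_lt_top.ne), hvol hr0.le, hvol (by linarith),
      ENNReal.ofReal_sub _ (pow_nonneg (by linarith) d), ENNReal.sub_mul (fun _ _ => hvt)]
  rw [hvol hr0.le]
  have hrd : ENNReal.ofReal (r ^ d) ≠ 0 := by
    rw [Ne, ENNReal.ofReal_eq_zero, not_le]; positivity
  rw [ENNReal.div_le_iff (mul_ne_zero hrd hv0) (ENNReal.mul_ne_top ENNReal.ofReal_ne_top hvt),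
    ← mul_assoc, ← ENNReal.ofReal_mul']
  · refine hle.trans_eq ?_
    congr 2
    rw [sub_mul, ← mul_pow, sub_mul, div_mul_cancel₀ _ hr0.ne', one_mul, one_mul]
  · positivity

/-- For an integrable `κ`, the mass transported out of a large ball is of smaller order than its
volume. -/
theorem tendsto_lintegral_leavingSet {κ : Space d → ℝ≥0∞} (hκm : Measurable κ)
    (hκ : ∫⁻ z, κ z ≠ ∞) :
    Tendsto (fun r : ℝ => (∫⁻ z, κ z * volume (leavingSet (Metric.closedBall 0 r) z)) /
      volume (Metric.closedBall (0 : Space d) r)) atTop (𝓝 0) := by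
  have h1 : Tendsto (fun r : ℝ => ∫⁻ z, κ z * (volume (leavingSet (Metric.closedBall 0 r) z) /
      volume (Metric.closedBall (0 : Space d) r))) atTop (𝓝 (∫⁻ _ : Space d, 0)) := by
    -- The volume ratio is at most 1, so κ itself dominates.
    refine tendsto_lintegral_filter_of_dominated_convergence κ (Eventually.of_forall fun r => ?_)
      (Eventually.of_forall fun r => ae_of_all _ fun z => ?_) hκ ?_
    · exact hκm.mul ((measurable_volume_leavingSet
        Metric.isClosed_closedBall.measurableSet).div_const _)
    · refine mul_le_of_le_one_right' (ENNReal.div_le_of_le_mul ?_)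
      rw [one_mul]
      exact measure_mono fun x hx => hx.1
    · filter_upwards [ae_lt_top hκm hκ] with z hz
      have := ENNReal.Tendsto.const_mul (tendsto_volume_leavingSet_closedBall z) (.inr hz.ne)
      simpa using this
  rw [lintegral_zero] at h1
  refine h1.congr fun r => ?_
  simp_rw [ENNReal.div_eq_inv_mul, mul_left_comm (κ _)]
  rw [lintegral_const_mul]
  exact hκm.mul (measurable_volume_leavingSet Metric.isClosed_closedBall.measurableSet)

variable [AddAction (Space d) Ω]
  {P : Measure Ω} {Ψ : Ω → Measure (Space d)} {τ : Ω → Space d → Option (Space d)}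
  {X : ℕ → Ω → Space d} {ζ : Ω → ℕ → Space d}

namespace IsUniformSample

variable [MeasurableVAdd₂ (Space d) Ω] [VAddInvariantMeasure (Space d) Ω P]

/-- Since γ²∫κ = γ, the Poisson term γλ(B) equals the same-cell pairs inside B plus those with one
point leaving B. The former cancel and the latter remain. -/
theorem variance_pointMeasure [IsProbabilityMeasure P] (hζ : IsUniformSample P τ X ζ)
    (h : IsInvariantPartition P Ψ τ) (hX : IsEnumeration P Ψ X) (hf : IsFair P Ψ τ)
    (h0 : intensity P Ψ ≠ 0) {B : Set (Space d)} (hB : MeasurableSet B)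
    (hB' : volume B ≠ ∞) :
    variance (fun ω => (pointMeasure (ζ ω)).real B) P
      = (intensity P Ψ ^ 2 * ∫⁻ z, coverProb P τ z * volume (leavingSet B z)).toReal := by
  have h1 := h.intensity_ne_top
  have hm : AEMeasurable (fun ω => pointMeasure (ζ ω) B) P :=
    (Measure.measurable_coe hB).comp_aemeasurable
      (measurable_pointMeasure.comp_aemeasurable hζ.aemeasurable)
  have hE := hζ.lintegral_pointMeasure h hX hf h0 hB
  have hE2 := hζ.lintegral_pointMeasure_sq h hX hf h0 hB
  have hJ := lintegral_lintegral_sub_add (coverProb P τ) h.measurable_coverProb hB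
  rw [h.lintegral_coverProb hf] at hJ
  set J := ∫⁻ x in B, ∫⁻ y in B, coverProb P τ (y - x)
  set J' := ∫⁻ z, coverProb P τ z * volume (leavingSet B z)
  set γ := intensity P Ψ
  have hJtop : J ≠ ∞ := by
    refine ne_top_of_le_ne_top ?_ (le_self_add.trans_eq hJ)
    exact ENNReal.mul_ne_top (ENNReal.inv_ne_top.2 h0) hB'
  have hJ2 : γ ^ 2 * J + γ ^ 2 * J' = γ * volume B := by
    rw [← mul_add, hJ, sq, mul_assoc, ← mul_assoc γ γ⁻¹, ENNReal.mul_inv_cancel h0 h1, one_mul]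
  have hM : ∫⁻ ω, pointMeasure (ζ ω) B ^ 2 ∂P = γ ^ 2 * J' + (γ * volume B) ^ 2 := by
    have hfin : γ ^ 2 * J ≠ ∞ := ENNReal.mul_ne_top (ENNReal.pow_ne_top h1) hJtop
    refine (ENNReal.add_left_inj hfin).1 ?_
    rw [hE2, mul_pow, ← hJ2]
    ring
  have hJ'top : γ ^ 2 * J' ≠ ∞ := by
    refine ne_top_of_le_ne_top (ENNReal.mul_ne_top h1 hB') (le_add_self.trans_eq hJ2)
  have hfin : ∀ᵐ ω ∂P, pointMeasure (ζ ω) B < ∞ :=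
    ae_lt_top' hm (hE ▸ ENNReal.mul_ne_top h1 hB')
  have hsq : Integrable (fun ω => (pointMeasure (ζ ω)).real B ^ 2) P := by
    have := integrable_toReal_of_lintegral_ne_top (hm.pow_const 2)
      (hM ▸ ENNReal.add_ne_top.2 ⟨hJ'top, ENNReal.pow_ne_top (ENNReal.mul_ne_top h1 hB')⟩)
    simpa only [ENNReal.toReal_pow, measureReal_def] using this
  have hL : MemLp (fun ω => (pointMeasure (ζ ω)).real B) 2 P :=
    (memLp_two_iff_integrable_sq hm.ennreal_toReal.aestronglyMeasurable).2 hsq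
  have e1 : ∫ ω, (pointMeasure (ζ ω)).real B ∂P = (γ * volume B).toReal := by
    rw [← hE]
    exact integral_toReal hm hfin
  have e2 : ∫ ω, (pointMeasure (ζ ω)).real B ^ 2 ∂P
      = (γ ^ 2 * J' + (γ * volume B) ^ 2).toReal := by
    rw [← hM, ← integral_toReal (hm.pow_const 2)
      (hfin.mono fun ω hω => ENNReal.pow_lt_top hω)]
    simp only [ENNReal.toReal_pow, measureReal_def]
  rw [variance_eq_sub hL, e1]
  simp only [Pi.pow_apply]
  rw [e2, ENNReal.toReal_add hJ'top (ENNReal.pow_ne_top (ENNReal.mul_ne_top h1 hB')),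
    ENNReal.toReal_pow, add_sub_cancel_right]

theorem isHyperuniform [IsProbabilityMeasure P] (hζ : IsUniformSample P τ X ζ)
    (h : IsInvariantPartition P Ψ τ) (hX : IsEnumeration P Ψ X) (hf : IsFair P Ψ τ)
    (h0 : intensity P Ψ ≠ 0) : IsHyperuniform P fun ω => pointMeasure (ζ ω) := by
  refine ⟨(hζ.isPointProcess h hX hf h0).toIsRandomMeasure, hζ.isStationary h hX hf h0,
    hζ.isLocallySquareIntegrable h hX hf h0, ?_⟩
  have h1 := tendsto_lintegral_leavingSet h.measurable_coverProb
    ((h.lintegral_coverProb hf).trans_ne (ENNReal.inv_ne_top.2 h0))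
  have h2 := ENNReal.Tendsto.const_mul (a := intensity P Ψ ^ 2) h1
    (.inr (ENNReal.pow_ne_top h.intensity_ne_top))
  rw [mul_zero] at h2
  have h3 := (ENNReal.tendsto_toReal ENNReal.zero_ne_top).comp h2
  refine h3.congr' ?_
  filter_upwards [eventually_ge_atTop 0] with r hr
  rw [smul_unitClosedBall_of_nonneg hr, hζ.variance_pointMeasure h hX hf h0
    Metric.isClosed_closedBall.measurableSet measure_closedBall_lt_top.ne, Function.comp_apply,
    ← mul_div_assoc, ENNReal.toReal_div, measureReal_def, div_eq_inv_mul]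

end IsUniformSample

end RandomMeasures

/-! ### Scaling and the structure factor -/

namespace RandomMeasures

section Scaling

variable {Ω : Type*} [MeasurableSpace Ω] {d : ℕ} {P : Measure Ω} {Φ : Ω → Measure (Space d)}
  {c : ℝ≥0∞}

theorem measurable_const_smul_measure {E : Type*} [MeasurableSpace E] (c : ℝ≥0∞) :
    Measurable fun μ : Measure E => c • μ := by
  refine Measure.measurable_of_measurable_coe _ fun B hB => ?_
  simp only [Measure.smul_apply, smul_eq_mul]
  exact (Measure.measurable_coe hB).const_mul c

theorem IsRandomMeasure.const_smul (hΦ : IsRandomMeasure P Φ) (hc : c ≠ ∞) :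
    IsRandomMeasure P fun ω => c • Φ ω := by
  refine ⟨(measurable_const_smul_measure c).comp_aemeasurable hΦ.aemeasurable, ?_⟩
  filter_upwards [hΦ.locallyFinite] with ω hω
  refine ⟨fun x => ?_⟩
  obtain ⟨s, hs, hs'⟩ := hω.finiteAtNhds x
  exact ⟨s, hs, by
    rw [Measure.smul_apply, smul_eq_mul]; exact ENNReal.mul_lt_top hc.lt_top hs'⟩

theorem IsStationary.const_smul (hΦ : IsStationary P Φ) (hm : AEMeasurable Φ P) (c : ℝ≥0∞) :
    IsStationary P fun ω => c • Φ ω := by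
  intro x
  have hs := (measurable_const_smul_measure (E := Space d) c).aemeasurable (μ := P.map Φ)
  have e1 : P.map (fun ω => shiftMeasure x (c • Φ ω))
      = (P.map fun ω => shiftMeasure x (Φ ω)).map fun μ => c • μ := by
    have hx : AEMeasurable (fun ω => shiftMeasure x (Φ ω)) P :=
      (measurable_shiftMeasure x).comp_aemeasurable hm
    rw [AEMeasurable.map_map_of_aemeasurable (by rw [hΦ x]; exact hs) hx]
    simp only [shiftMeasure, Measure.map_smul]
    rfl
  rw [e1, hΦ x, AEMeasurable.map_map_of_aemeasurable hs hm]
  rfl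

theorem IsLocallySquareIntegrable.const_smul (hΦ : IsLocallySquareIntegrable P Φ) (hc : c ≠ ∞) :
    IsLocallySquareIntegrable P fun ω => c • Φ ω := by
  intro B hB hB'
  simp_rw [Measure.smul_apply, smul_eq_mul, mul_pow]
  rw [lintegral_const_mul' _ _ (ENNReal.pow_ne_top hc)]
  exact ENNReal.mul_lt_top (ENNReal.pow_lt_top hc.lt_top) (hΦ B hB hB')

theorem intensity_const_smul (hc : c ≠ ∞) :
    intensity P (fun ω => c • Φ ω) = c * intensity P Φ :=
  lintegral_const_mul' _ _ hc

theorem reducedSecondMoment_const_smul (hΦ : IsRandomMeasure P Φ)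
    (hm : AEMeasurable (fun ω => (((Φ ω).restrict (unitCube d)).prod (Φ ω)).map
      fun p => p.2 - p.1) P) :
    reducedSecondMoment P (fun ω => c • Φ ω) = c ^ 2 • reducedSecondMoment P Φ := by
  have hae : (fun ω => (((c • Φ ω).restrict (unitCube d)).prod (c • Φ ω)).map fun p => p.2 - p.1)
      =ᵐ[P] fun ω => c ^ 2 • (((Φ ω).restrict (unitCube d)).prod (Φ ω)).map fun p => p.2 - p.1 := by
    filter_upwards [hΦ.locallyFinite] with ω hω
    rw [Measure.restrict_smul, Measure.prod_smul_left, Measure.prod_smul_right, smul_smul,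
      Measure.map_smul, sq]
  have hm' : AEMeasurable (fun ω => c ^ 2 • (((Φ ω).restrict (unitCube d)).prod (Φ ω)).map
      fun p => p.2 - p.1) P := (measurable_const_smul_measure _).comp_aemeasurable hm
  ext S hS
  rw [reducedSecondMoment, Measure.bind_congr_right hae, Measure.bind_apply hS hm',
    reducedSecondMoment,
    Measure.smul_apply, Measure.bind_apply hS hm, smul_eq_mul, ← lintegral_const_mul'']
  · rfl
  · exact (Measure.measurable_coe hS).comp_aemeasurable hm

/-- Second-order quantities scale by c² and the intensity by c, so the normalized spectral density
scales by c. -/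
theorem IsStructureFactor.const_smul {S : Space d → ℝ} (hΦ : IsStructureFactor P Φ S)
    (hm : AEMeasurable (fun ω => (((Φ ω).restrict (unitCube d)).prod (Φ ω)).map
      fun p => p.2 - p.1) P) (hc : c ≠ ∞) :
    IsStructureFactor P (fun ω => c • Φ ω) fun k => c.toReal * S k := by
  have hi := intensity_const_smul (P := P) (Φ := Φ) hc
  have hr := reducedSecondMoment_const_smul (c := c) hΦ.randomMeasure hm
  refine ⟨hΦ.randomMeasure.const_smul hc,
    hΦ.stationary.const_smul hΦ.randomMeasure.aemeasurable c,
    hΦ.squareIntegrable.const_smul hc, ?_, continuous_const.mul hΦ.continuous,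
    fun k => mul_nonneg ENNReal.toReal_nonneg (hΦ.nonneg k), ?_⟩
  · obtain ⟨ν, hν⟩ := hΦ.finiteVariation
    refine ⟨c.toReal ^ 2 • ν, fun B hB hB' => ?_⟩
    rw [hi, hr, _root_.smul_apply, hν B hB hB', measureReal_ennreal_smul_apply,
      ENNReal.toReal_mul, ENNReal.toReal_pow, smul_eq_mul]
    ring
  · have hSm : Measurable fun k => ENNReal.ofReal ((intensity P Φ).toReal * S k) :=
      (hΦ.continuous.measurable.const_mul _).ennreal_ofReal
    have hd : (volume : Measure (Space d)).withDensity (fun k => ENNReal.ofReal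
          ((intensity P fun ω => c • Φ ω).toReal * (c.toReal * S k)))
        = c ^ 2 • volume.withDensity
          fun k => ENNReal.ofReal ((intensity P Φ).toReal * S k) := by
      rw [← withDensity_smul _ hSm]
      congr 1
      funext k
      rw [hi, ENNReal.toReal_mul, Pi.smul_apply, smul_eq_mul, ← ENNReal.ofReal_toReal
        (ENNReal.pow_ne_top hc : c ^ 2 ≠ ∞), ← ENNReal.ofReal_mul ENNReal.toReal_nonneg,
        ENNReal.toReal_pow]
      congr 1
      ring
    rw [hd]
    obtain ⟨h1, h2, h3⟩ := hΦ.density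
    refine ⟨?_, fun f g hf hg => (h2 f g hf hg).smul_measure (ENNReal.pow_ne_top hc),
      fun f g hf hg => ?_⟩
    · rw [← hd]
      exact IsLocallyFiniteMeasure.withDensity_ofReal
        (continuous_const.mul (continuous_const.mul hΦ.continuous))
    · have key := h3 f g hf hg
      rw [hr, hi, integral_smul_measure, integral_smul_measure, ENNReal.toReal_mul,
        ENNReal.toReal_pow, Complex.real_smul, smul_eq_mul, mul_left_comm, ← key]
      push_cast
      ring

end Scaling

variable {Ω : Type*} [MeasurableSpace Ω] {d : ℕ} [AddAction (Space d) Ω]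
  {P : Measure Ω} {Ψ : Ω → Measure (Space d)} {τ : Ω → Space d → Option (Space d)}
  {X : ℕ → Ω → Space d} {ζ : Ω → ℕ → Space d}
  [MeasurableVAdd₂ (Space d) Ω] [VAddInvariantMeasure (Space d) Ω P]

theorem IsUniformSample.isStructureFactor [IsProbabilityMeasure P] (hζ : IsUniformSample P τ X ζ)
    (h : IsInvariantPartition P Ψ τ) (hX : IsEnumeration P Ψ X) (hf : IsFair P Ψ τ)
    (h0 : intensity P Ψ ≠ 0) :
    IsStructureFactor P (fun ω => pointMeasure (ζ ω)) fun k => (intensity P Ψ).toReal ^ 2 *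
      (((intensity P Ψ).toReal ^ 2)⁻¹ - ∫ ω, indicatorFourierSq (zeroCell τ ω) k ∂P) := by
  have h1 := h.intensity_ne_top
  have hγ : 0 < (intensity P Ψ).toReal := ENNReal.toReal_pos h0 h1
  have hγ' : ((intensity P Ψ).toReal : ℂ) ≠ 0 := by exact_mod_cast hγ.ne'
  have hκ : ∫⁻ y, coverProb P τ y ≠ ∞ := (h.lintegral_coverProb hf).trans_ne
    (ENNReal.inv_ne_top.2 h0)
  have hκm := h.measurable_coverProb
  have hκi : Integrable fun y => (coverProb P τ y).toReal :=
    integrable_toReal_of_lintegral_ne_top hκm.aemeasurable hκ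
  have hi := hζ.intensity_pointMeasure h hX hf h0
  have hr := hζ.reducedSecondMoment_add h hX hf h0
  set S : Space d → ℝ := fun k => (intensity P Ψ).toReal ^ 2 *
    (((intensity P Ψ).toReal ^ 2)⁻¹ - ∫ ω, indicatorFourierSq (zeroCell τ ω) k ∂P) with hS
  have hSC (k : Space d) : (S k : ℂ)
      = 1 - (intensity P Ψ).toReal * fourierTr (fun y => (coverProb P τ y).toReal) k := by
    rw [hS]
    push_cast [h.integral_indicatorFourierSq_zeroCell hf h0 k]
    field_simp
  have hSR (k : Space d) : S k = (1 - (intensity P Ψ).toReal *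
      fourierTr (fun y => (coverProb P τ y).toReal) k : ℂ).re := by
    rw [← hSC, Complex.ofReal_re]
  have hScont : Continuous S := by
    rw [show S = fun k => _ from funext hSR]
    exact Complex.continuous_re.comp
      (continuous_const.sub (continuous_const.mul (continuous_fourierTr hκi)))
  -- Nonnegativity uses |κ̂| ≤ ∫κ = γ⁻¹. The upper bound S ≤ 1 instead comes from the form with a
  -- mean square.
  have hS0 (k : Space d) : 0 ≤ S k := by
    rw [hSR, Complex.sub_re, Complex.one_re, Complex.re_ofReal_mul, sub_nonneg]
    have e1 : ∫ y, |(coverProb P τ y).toReal| = (intensity P Ψ).toReal⁻¹ := by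
      simp_rw [abs_of_nonneg ENNReal.toReal_nonneg]
      rw [integral_toReal hκm.aemeasurable (ae_lt_top hκm hκ), h.lintegral_coverProb hf,
        ENNReal.toReal_inv]
    calc _ ≤ (intensity P Ψ).toReal * (intensity P Ψ).toReal⁻¹ := by
          refine mul_le_mul_of_nonneg_left ?_ hγ.le
          exact (Complex.re_le_norm _).trans ((norm_fourierTr_le _ k).trans_eq e1)
      _ = 1 := mul_inv_cancel₀ hγ.ne'
  have hS1 (k : Space d) : S k ≤ 1 := by
    have : 0 ≤ ∫ ω, indicatorFourierSq (zeroCell τ ω) k ∂P :=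
      integral_nonneg fun ω => indicatorFourierSq_nonneg _ _
    simp only [hS, mul_sub]
    rw [mul_inv_cancel₀ (by positivity)]
    exact sub_le_self _ (by positivity)
  exact ⟨(hζ.isPointProcess h hX hf h0).toIsRandomMeasure, hζ.isStationary h hX hf h0,
    hζ.isLocallySquareIntegrable h hX hf h0,
    covarianceMeasureFiniteVariation_of_add_eq h1 hκ hi hr, hScont, hS0,
    isBartlettSpectralMeasure_of_add_eq h1 hκ hκm hi hr hScont hS0 hS1 hSC⟩

end RandomMeasures

theorem mainTheorem6 {d : ℕ} (hd : 0 < d)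
    {Ω : Type*} [MeasurableSpace Ω] [AddAction (Space d) Ω] [MeasurableVAdd₂ (Space d) Ω]
    (P : Measure Ω) [IsProbabilityMeasure P] [VAddInvariantMeasure (Space d) Ω P]
    (Ψ : Ω → Measure (Space d)) (τ : Ω → Space d → Option (Space d))
    (hpart : IsInvariantPartition P Ψ τ) (hfair : IsFair P Ψ τ)
    (Z : Ω → Space d → Space d) (hZ : IsConditionallyUniform P Ψ τ Z)
    (γ : ℝ) (hγ : γ = (intensity P Ψ).toReal) :
    IsPointProcess P (displaced Ψ Z) ∧
    IsHyperuniform P (displaced Ψ Z) ∧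
    IsStructureFactor P (displaced Ψ Z)
      (fun k => γ ^ 2 * ((γ ^ 2)⁻¹ - ∫ ω, indicatorFourierSq (zeroCell τ ω) k ∂P)) ∧
    IsStructureFactor P (fun ω => (intensity P Ψ)⁻¹ • displaced Ψ Z ω)
      (fun k => γ * ((γ ^ 2)⁻¹ - ∫ ω, indicatorFourierSq (zeroCell τ ω) k ∂P)) ∧
    (∀ k : Space d, ∫ ω, indicatorFourierSq (cell τ ω 0) k ∂(palm P Ψ)
      = ∫ ω, indicatorFourierSq (zeroCell τ ω) k ∂P) := by
  subst hγ
  have h0 := hpart.intensity_ne_zero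
  have h1 := hpart.intensity_ne_top
  obtain ⟨X, hX, hm, hlaw⟩ := hZ.exists_law hpart hfair h0
  have hζ : IsUniformSample P τ X fun ω n => Z ω (X n ω) := ⟨hm, hlaw⟩
  have hae := (hX.displaced_ae_eq Z).symm
  have hS := hζ.isStructureFactor hpart hX hfair h0
  refine ⟨(hζ.isPointProcess hpart hX hfair h0).congr hae,
    (hζ.isHyperuniform hpart hX hfair h0).congr hae, hS.congr hae, ?_,
    hpart.integral_indicatorFourierSq_palm hX hfair h0⟩
  have hae' : (fun ω => (intensity P Ψ)⁻¹ • pointMeasure fun n => Z ω (X n ω)) =ᵐ[P]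
      fun ω => (intensity P Ψ)⁻¹ • displaced Ψ Z ω := hae.mono fun ω hω => congrArg _ hω
  have hS' := (hS.const_smul (measurable_map_sub_prod_pointMeasure.comp_aemeasurable hm)
    (ENNReal.inv_ne_top.2 h0)).congr hae'
  have h2 : (intensity P Ψ).toReal ≠ 0 := (ENNReal.toReal_pos h0 h1).ne'
  convert! hS' using 2 with k
  -- Scaling by γ⁻¹ turns the prefactor γ² into γ.
  rw [ENNReal.toReal_inv, ← mul_assoc, sq, inv_mul_cancel_left₀ h2]
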